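/- Let $d\in\{2,3\}$, let $\mathcal D\subset\mathbb R^d$ be a bounded open set (for instance a bounded domain), $\kappa\ge 0$, $\Omega\in\mathbb R$, and let $W\in L^\infty(\mathcal D,\mathbb R)$ satisfy $W(x)\ge\Omega^2|x|^2$ for a.e. $x\in\mathcal D$. Let $V=H^1_0(\mathcal D,\mathbb C)$ (the closure of $C_c^\infty(\mathcal D,\mathbb C)$ in $H^1$), let $\|\cdot\|$ be the $L^2(\mathcal D)$-norm and $(v,w)_H=\Re\int_{\mathcal D}v\,\overline w\,dx$. Put $R(x,y)=(y,-x)$ if $d=2$ and $R(x,y,z)=(y,-x,0)$ if $d=3$, $\nabla_R v=\nabla v+\mathrm i\tfrac{\Omega}{2}R^\top v$, $W_R(x)=W(x)-\tfrac14\Omega^2|x|^2$, and define, for $u,v,w\in V$ (with $u\neq0$ in the definitions of $A$ and $J$), $$E(u)=\tfrac12\int_{\mathcal D}|\nabla_R u|^2+W_R|u|^2+\tfrac{\kappa}{2}|u|^4\,dx,$$ $$\langle A(u,v),w\rangle=\Re\Big(\int_{\mathcal D}\nabla_R v\cdot\overline{\nabla_R w}+W_R\,v\,\overline w\,dx+\frac{\kappa}{\|u\|^2}\int_{\mathcal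 D}|u|^2v\,\overline w\,dx\Big),$$ $$\langle J(u)v,w\rangle=\Re\Big(\int_{\mathcal D}\nabla_R v\cdot\overline{\nabla_R w}+W_R\,v\,\overline w\,dx+\frac{\kappa}{\|u\|^2}\int_{\mathcal D}(u\overline v+2v\overline u)\,u\,\overline w\,dx-\frac{2\kappa\,(u,v)_H}{\|u\|^4}\int_{\mathcal D}|u|^2u\,\overline w\,dx\Big);$$ thus $J(u)$ is the real Fréchet derivative of $\mathcal A(u):=A(u,u)$ at $u$. Let $\mathcal I u=(u,\cdot)_H\in V^*$ and $J_\sigma(u)=J(u)+\sigma\mathcal I:V\to V^*$, where $V^*$ is the real dual of $V$. An $L^2$-normalized eigenfunction with eigenvalue $\lambda\in\mathbb R$ is a $u\in V$ with $\|u\|=1$ and $\mathcal A(u)=\lambda\,\mathcal I u$. Given $u^0\in V$ with $\|u^0\|=1$, a shift $\sigma$ and step sizes $\tau_n>0$, the damped $J$-method is the iteration $$\tilde u^{n+1}=(1-\tau_n)u^n+\tau_n\gamma_n\,J_\sigma(u^n)^{-1}\mathcal I u^n,\qquad \gamma_n^{-1}=(J_\sigma(u^n)^{-1}\mathcal I u^n,u^n)_H,\qquad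 u^{n+1}=\tilde u^{n+1}/\|\tilde u^{n+1}\|.$$ **Theorem.** Let $u^0\in V$ with $\|u^0\|=1$. There is $\tau^*>0$ (depending on $u^0$ and the data $\mathcal D,W,\Omega,\kappa$, but not on $\sigma$) such that for every shift $\sigma\ge\frac43E(u^0)$ and all step sizes with $0<\tau_n\le\tau^*$ that are uniformly bounded away from zero, the damped $J$-method is well-posed (each $J_\sigma(u^n)$ is invertible and no division by zero occurs), satisfies $E(u^{n+1})\le E(u^n)$ for all $n$, with strict inequality if $u^n$ is not an eigenfunction, and the following holds. The limit $E^*=\lim_{n\to\infty}E(u^n)$ exists, and a subsequence of $(u^n)$ converges strongly in $H^1(\mathcal D)$ to an $L^2$-normalized eigenfunction $u^*\in V$ with some eigenvalue $\lambda^*>0$ and $E(u^*)=E^*$. Moreover: 1. If $K\subset V$ is a closed set that contains all iterates $u^n$ (for instance $K=V$, or the set of non-negative functions if all $u^n$ are non-negative), and $u^*$ is the only $L^2$-normalized eigenfunction in $K$ on the energy level $E^*$, then the whole sequence $u^n$ converges to $u^*$ strongly in $H^1(\mathcal D)$. 2. If $u^*$ is the only $L^2$-normalized eigenfunction on the energy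 level $E^*$ up to constant phase factors (that is, every such eigenfunction is $c\,u^*$ with $c\in\mathbb C$, $|c|=1$), then the whole sequence converges up to phase factors: there are $c_n\in\mathbb C$, $|c_n|=1$, such that $c_nu^n\to u^*$ strongly in $H^1(\mathcal D)$. -/

import Mathlib

open MeasureTheory Filter Topology
open scoped ContDiff ComplexConjugate

noncomputable section

namespace GrossPitaevskii

/-- Physical space `ℝᵈ` with its Euclidean norm. -/
abbrev Space (d : ℕ) : Type := EuclideanSpace ℝ (Fin d)

/-- Values of complex gradients. -/
abbrev CVec (d : ℕ) : Type := EuclideanSpace ℂ (Fin d)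

/-- `L²(D; ℂ)`. -/
abbrev L2 {d : ℕ} (D : Set (Space d)) : Type := Lp ℂ 2 (volume.restrict D)

/-- `L²(D; ℂᵈ)`. -/
abbrev L2Vec {d : ℕ} (D : Set (Space d)) : Type := Lp (CVec d) 2 (volume.restrict D)

/-- The classical gradient `(∂₁φ, …, ∂_dφ)` of a function `φ : ℝᵈ → ℂ`. -/
def classicalGrad {d : ℕ} (φ : Space d → ℂ) (x : Space d) : CVec d :=
  WithLp.toLp 2 fun i => fderiv ℝ φ x (EuclideanSpace.single i 1)

/-- `φ ∈ C_c^∞(D; ℂ)`. -/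
def IsTestFunction {d : ℕ} (D : Set (Space d)) (φ : Space d → ℂ) : Prop :=
  ContDiff ℝ ∞ φ ∧ HasCompactSupport φ ∧ tsupport φ ⊆ D

lemma classicalGrad_add {d : ℕ} {φ ψ : Space d → ℂ} (hφ : ContDiff ℝ ∞ φ)
    (hψ : ContDiff ℝ ∞ ψ) (x : Space d) :
    classicalGrad (φ + ψ) x = classicalGrad φ x + classicalGrad ψ x := by
  ext i
  have h1 : DifferentiableAt ℝ φ x := (hφ.differentiable (by simp)).differentiableAt
  have h2 : DifferentiableAt ℝ ψ x := (hψ.differentiable (by simp)).differentiableAt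
  simp [classicalGrad, fderiv_add h1 h2]

lemma classicalGrad_smul {d : ℕ} {φ : Space d → ℂ} (hφ : ContDiff ℝ ∞ φ) (c : ℂ)
    (x : Space d) : classicalGrad (c • φ) x = c • classicalGrad φ x := by
  ext i
  have h1 : DifferentiableAt ℝ φ x := (hφ.differentiable (by simp)).differentiableAt
  simp [classicalGrad, fderiv_const_smul h1 c]

/-- All pairs `(φ, ∇φ)`, `φ ∈ C_c^∞(D; ℂ)`, in `L²(D; ℂ) × L²(D; ℂᵈ)`. The norm of the pair
`(φ, ∇φ)` in the Hilbert space product is the `H¹`-norm of `φ`. -/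
def testGraph {d : ℕ} (D : Set (Space d)) : Submodule ℂ (WithLp 2 (L2 D × L2Vec D)) where
  carrier := {p | ∃ φ : Space d → ℂ, IsTestFunction D φ ∧
    p.fst =ᵐ[volume.restrict D] φ ∧ p.snd =ᵐ[volume.restrict D] classicalGrad φ}
  zero_mem' := by
    refine ⟨0, ⟨contDiff_const, HasCompactSupport.zero, by simp⟩, ?_, ?_⟩
    · exact Lp.coeFn_zero _ _ _
    · filter_upwards [Lp.coeFn_zero (CVec d) 2 (volume.restrict D)] with x hx
      rw [WithLp.zero_snd, hx]
      ext i
      simp [classicalGrad]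
  add_mem' := by
    rintro p q ⟨φ, ⟨hφ, hφc, hφD⟩, hp1, hp2⟩ ⟨ψ, ⟨hψ, hψc, hψD⟩, hq1, hq2⟩
    refine ⟨φ + ψ, ⟨hφ.add hψ, hφc.add hψc,
      (tsupport_add φ ψ).trans (Set.union_subset hφD hψD)⟩, ?_, ?_⟩
    · filter_upwards [Lp.coeFn_add p.fst q.fst, hp1, hq1] with x hx h1 h2
      rw [WithLp.add_fst, hx, Pi.add_apply, Pi.add_apply, h1, h2]
    · filter_upwards [Lp.coeFn_add p.snd q.snd, hp2, hq2] with x hx h1 h2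
      rw [WithLp.add_snd, hx, Pi.add_apply, h1, h2, classicalGrad_add hφ hψ]
  smul_mem' := by
    rintro c p ⟨φ, ⟨hφ, hφc, hφD⟩, hp1, hp2⟩
    refine ⟨c • φ, ⟨contDiff_const.smul hφ, hφc.smul_left (f := fun _ => c),
      (tsupport_smul_subset_right (fun _ => c) φ).trans hφD⟩, ?_, ?_⟩
    · filter_upwards [Lp.coeFn_smul c p.fst, hp1] with x hx h1
      rw [WithLp.smul_fst, hx, Pi.smul_apply, Pi.smul_apply, h1]
    · filter_upwards [Lp.coeFn_smul c p.snd, hp2] with x hx h1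
      rw [WithLp.smul_snd, hx, Pi.smul_apply, h1, classicalGrad_smul hφ]

/-- The Sobolev space `V = H¹₀(D; ℂ)`, the closure of `C_c^∞(D; ℂ)` in the `H¹`-norm. An element
is stored as the pair `(u, ∇u)` of a function and its weak gradient, so that the norm of `V` is
the full `H¹`-norm `(‖u‖² + ‖∇u‖²)^{1/2}`. -/
def H10 {d : ℕ} (D : Set (Space d)) : Submodule ℂ (WithLp 2 (L2 D × L2Vec D)) :=
  (testGraph D).topologicalClosure

section Setting

variable {d : ℕ} {D : Set (Space d)}

/-- The function `u` itself (a representative, determined almost everywhere in `D`). -/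
def fn (u : H10 D) : Space d → ℂ := u.1.fst

/-- The weak gradient `∇u`. -/
def grad (u : H10 D) : Space d → CVec d := u.1.snd

/-- The `L²`-norm `‖u‖`. -/
def l2Norm (u : H10 D) : ℝ := ‖u.1.fst‖

/-- The real inner product `(v, w)_H = Re ∫_D v w̄ dx` of `H = L²(D; ℂ)`. -/
def hInner (v w : H10 D) : ℝ := (∫ x in D, fn v x * conj (fn w x)).re

/-- The `k`-th coordinate of `x`, counted from zero, and zero if there is none. -/
def coord (x : Space d) (k : ℕ) : ℝ := if h : k < d then x ⟨k, h⟩ else 0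

/-- The vector field `R(x, y) = (y, -x)` if `d = 2`, `R(x, y, z) = (y, -x, 0)` if `d = 3`. -/
def rotField (x : Space d) (i : Fin d) : ℝ :=
  if i.val = 0 then coord x 1 else if i.val = 1 then -coord x 0 else 0

/-- The rotational gradient `∇_R v = ∇v + i (Ω/2) Rᵀ v`. -/
def rotGrad (Ω : ℝ) (v : H10 D) (x : Space d) : CVec d :=
  WithLp.toLp 2 fun i => grad v x i + Complex.I * (Ω / 2) * (rotField x i : ℂ) * fn v x

/-- The potential `W_R(x) = W(x) - Ω² |x|² / 4`. -/
def rotPotential (W : Space d → ℝ) (Ω : ℝ) (x : Space d) : ℝ :=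
  W x - 1 / 4 * Ω ^ 2 * ‖x‖ ^ 2

/-- `∫_D ∇_R v · conj (∇_R w) + W_R v w̄ dx`. -/
def linearForm (W : Space d → ℝ) (Ω : ℝ) (v w : H10 D) : ℂ :=
  ∫ x in D, ((∑ i, rotGrad Ω v x i * conj (rotGrad Ω w x i))
    + (rotPotential W Ω x : ℂ) * fn v x * conj (fn w x))

/-- The Gross-Pitaevskii operator `⟨A(u, v), w⟩`, nonlinear in `u` and real-linear in `v`. -/
def opA (W : Space d → ℝ) (Ω κ : ℝ) (u v w : H10 D) : ℝ :=
  (linearForm W Ω v w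
    + ((κ / l2Norm u ^ 2 : ℝ) : ℂ) *
      ∫ x in D, ((‖fn u x‖ ^ 2 : ℝ) : ℂ) * fn v x * conj (fn w x)).re

/-- The Gross-Pitaevskii energy `E(u)`. -/
def energy (W : Space d → ℝ) (Ω κ : ℝ) (u : H10 D) : ℝ :=
  1 / 2 * ∫ x in D, (‖rotGrad Ω u x‖ ^ 2 + rotPotential W Ω x * ‖fn u x‖ ^ 2
    + κ / 2 * ‖fn u x‖ ^ 4)

/-- `u` is an `L²`-normalized eigenfunction with eigenvalue `lam`: `A(u, u) = lam I u` in `V*`. -/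
def IsEigenpair (W : Space d → ℝ) (Ω κ : ℝ) (u : H10 D) (lam : ℝ) : Prop :=
  l2Norm u = 1 ∧ ∀ w : H10 D, opA W Ω κ u u w = lam * hInner u w

/-- The `J`-operator `⟨J(u) v, w⟩`, i.e. the real Fréchet derivative of `u ↦ A(u, u)` at `u` in
direction `v`, tested with `w`. -/
def opJ (W : Space d → ℝ) (Ω κ : ℝ) (u v w : H10 D) : ℝ :=
  (linearForm W Ω v w
    + ((κ / l2Norm u ^ 2 : ℝ) : ℂ) *
      (∫ x in D, (fn u x * conj (fn v x) + 2 * fn v x * conj (fn u x)) * fn u x * conj (fn w x))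
    - ((2 * κ * hInner u v / l2Norm u ^ 4 : ℝ) : ℂ) *
      ∫ x in D, ((‖fn u x‖ ^ 2 : ℝ) : ℂ) * fn u x * conj (fn w x)).re

/-- The shifted operator `J_σ(u) = J(u) + σ I`. -/
def opJσ (W : Space d → ℝ) (Ω κ σ : ℝ) (u v w : H10 D) : ℝ :=
  opJ W Ω κ u v w + σ * hInner v w

/-- `J_σ(u) : V → V*` is invertible, `V*` being the space of bounded real-linear functionals. -/
def JσInvertible (W : Space d → ℝ) (Ω κ σ : ℝ) (u : H10 D) : Prop :=
  ∀ F : H10 D →L[ℝ] ℝ, ∃! z : H10 D, ∀ w : H10 D, opJσ W Ω κ σ u z w = F w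

open Classical in
/-- `J_σ(u)⁻¹ I u`: the unique `z ∈ V` with `⟨J_σ(u) z, w⟩ = (u, w)_H` for all `w ∈ V`
(zero if there is no such unique `z`). -/
def JσInv (W : Space d → ℝ) (Ω κ σ : ℝ) (u : H10 D) : H10 D :=
  if h : ∃! z : H10 D, ∀ w : H10 D, opJσ W Ω κ σ u z w = hInner u w then h.exists.choose else 0

/-- `γ⁻¹ = (J_σ(u)⁻¹ I u, u)_H`. -/
def gammaInv (W : Space d → ℝ) (Ω κ σ : ℝ) (u : H10 D) : ℝ :=
  hInner (JσInv W Ω κ σ u) u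

/-- The unnormalized iterate `(1 - τ) u + τ γ J_σ(u)⁻¹ I u`. -/
def dampedTilde (W : Space d → ℝ) (Ω κ σ τ : ℝ) (u : H10 D) : H10 D :=
  ((1 - τ : ℝ) : ℂ) • u + ((τ * (gammaInv W Ω κ σ u)⁻¹ : ℝ) : ℂ) • JσInv W Ω κ σ u

/-- One step of the damped `J`-method with step size `τ`. -/
def dampedStep (W : Space d → ℝ) (Ω κ σ τ : ℝ) (u : H10 D) : H10 D :=
  (((l2Norm (dampedTilde W Ω κ σ τ u))⁻¹ : ℝ) : ℂ) • dampedTilde W Ω κ σ τ u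

/-- The step of the damped `J`-method is well-posed: `J_σ(u)` is invertible and nothing is divided
by zero. -/
def StepWellPosed (W : Space d → ℝ) (Ω κ σ τ : ℝ) (u : H10 D) : Prop :=
  JσInvertible W Ω κ σ u ∧ gammaInv W Ω κ σ u ≠ 0 ∧ l2Norm (dampedTilde W Ω κ σ τ u) ≠ 0

/-- The iterates `uⁿ` of the damped `J`-method with starting value `u₀` and step sizes `τₙ`. -/
def dampedJ (W : Space d → ℝ) (Ω κ σ : ℝ) (τ : ℕ → ℝ) (u₀ : H10 D) : ℕ → H10 D
  | 0 => u₀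
  | n + 1 => dampedStep W Ω κ σ (τ n) (dampedJ W Ω κ σ τ u₀ n)

end Setting

end GrossPitaevskii

end

open scoped RealInnerProductSpace ENNReal

/-! ### The abstract problem on a real Hilbert space -/

noncomputable section

/-! The damped iterate is `u + τ v` with search direction `v = γ z - u`, `z = J_σ(u)⁻¹ I u`. The
factor `γ` makes `v` orthogonal to `u` in `L²`, and since `J_σ(u) u = E'(u) + σ I u`, the direction
satisfies `J_σ(u) v = (γ - σ) I u - E'(u)`. Tested with `v`, the multiplier drops out: `⟨J_σ(u) v,
v⟩ = -⟨E'(u), v⟩`. For `σ ≥ 4/3 E(u)` a completed square gives `a(v, v) ≤ ⟨J_σ(u) v, v⟩` (`a_le_J`),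
so `J_σ(u)` is invertible by Lax-Milgram and `v` is a descent direction of slope at most `-a(v, v)`.

The energy is a quartic polynomial along lines, and its remainder is at most `τ² R a(v, v)` with `R`
depending only on the energy level. Hence `E(u + τ v) ≤ E(u) - τ/2 a(v, v)` for `τ ≤ 1/(2R)`. By
Pythagoras `‖u + τ v‖ ≥ 1`, so normalization does not increase the energy (`damped_step`).

Energies decrease and are nonnegative, so steps bounded away from zero force `vⁿ → 0` in `V`: the
eigenvalue residual vanishes. The iterates are bounded in `V`, and Rellich gives an `L²`-Cauchy
subsequence. The residual identity bounds `a(uⁿ, w)` by the `L²`-norm of `w` up to a vanishing term;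
applied to differences `w` of iterates, it upgrades this to convergence in `V`, and the limit is an
eigenfunction (`exists_subseq_tendsto_eigen`). Every subsequence has such a limit on the level `E*`,
so uniqueness there gives convergence of the whole sequence.

The argument runs for an abstract `GPForm` with `B(u, v) = Re(u v̄)` in mind. The analysis that
follows it supplies coercivity, the Sobolev bounds in `L⁴` and `L⁶`, and compactness on `H¹₀(D)`. -/

/-- The abstract data of a Gross-Pitaevskii type problem on a real Hilbert space `V` with pivot
space `H`: a coercive symmetric form `a`, the embedding `ι : V → H`, and a symmetric bilinear map
`B : V × V → X` whose squared norm yields the quartic part of the energy. -/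
structure GPForm (V H X : Type*) [NormedAddCommGroup V] [InnerProductSpace ℝ V]
    [NormedAddCommGroup H] [InnerProductSpace ℝ H]
    [NormedAddCommGroup X] [InnerProductSpace ℝ X] where
  a : V →L[ℝ] V →L[ℝ] ℝ
  ι : V →L[ℝ] H
  B : V →L[ℝ] V →L[ℝ] X
  κ : ℝ
  α : ℝ
  Cb : ℝ
  κ_nonneg : 0 ≤ κ
  α_pos : 0 < α
  Cb_nonneg : 0 ≤ Cb
  a_symm : ∀ v w, a v w = a w v
  a_coercive : ∀ v, α * ‖v‖ ^ 2 ≤ a v v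
  B_symm : ∀ v w, B v w = B w v
  -- Besides Cauchy-Schwarz, this is all that the coercivity of `J_σ(u)` needs from the
  -- nonlinearity.
  B_sq_le : ∀ u v, ‖B u v‖ ^ 2 ≤ ⟪B u u, B v v⟫
  -- Only the weak norm of `w` enters; this is what turns `H`-convergence of iterates into
  -- `V`-convergence.
  B_sub : ∀ u w, |⟪B u u, B u w⟫| ≤ Cb * ‖u‖ ^ 3 * ‖ι w‖
  ι_compact : ∀ v : ℕ → V, (∃ M, ∀ n, ‖v n‖ ≤ M) →
    ∃ φ : ℕ → ℕ, StrictMono φ ∧ CauchySeq fun n => ι (v (φ n))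

namespace GPForm

variable {V H X : Type*} [NormedAddCommGroup V] [InnerProductSpace ℝ V]
  [NormedAddCommGroup H] [InnerProductSpace ℝ H]
  [NormedAddCommGroup X] [InnerProductSpace ℝ X] (S : GPForm V H X)

/-- The energy `½ a(u, u) + κ/4 ‖B(u, u)‖²`. -/
def E (u : V) : ℝ := 1 / 2 * S.a u u + S.κ / 4 * ‖S.B u u‖ ^ 2

/-- The derivative of the energy at `u`, tested with `w`. -/
def dE (u w : V) : ℝ := S.a u w + S.κ * ⟪S.B u u, S.B u w⟫

/-- The shifted `J`-operator `⟨J_σ(u) v, w⟩`. -/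
def J (σ : ℝ) (u v w : V) : ℝ :=
  S.a v w + S.κ / ‖S.ι u‖ ^ 2 * (2 * ⟪S.B u v, S.B u w⟫ + ⟪S.B u u, S.B v w⟫)
    - 2 * S.κ * ⟪S.ι u, S.ι v⟫ / ‖S.ι u‖ ^ 4 * ⟪S.B u u, S.B u w⟫ + σ * ⟪S.ι v, S.ι w⟫

/-- The inner product of a real inner product space as a bounded bilinear map. -/
def innerBilin (X : Type*) [NormedAddCommGroup X] [InnerProductSpace ℝ X] : X →L[ℝ] X →L[ℝ] ℝ :=
  (innerₗ X).mkContinuous₂ 1 fun x y => by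
    simpa using abs_real_inner_le_norm x y

@[simp] lemma innerBilin_apply (x y : X) : innerBilin X x y = ⟪x, y⟫ := rfl

/-- `J_σ(u)` as a bounded bilinear form. -/
def Jform (σ : ℝ) (u : V) : V →L[ℝ] V →L[ℝ] ℝ :=
  S.a + (S.κ / ‖S.ι u‖ ^ 2) • ((2 : ℝ) • (innerBilin X).bilinearComp (S.B u) (S.B u)
      + ContinuousLinearMap.compL ℝ V X ℝ (innerBilin X (S.B u u)) ∘L S.B)
    - (2 * S.κ / ‖S.ι u‖ ^ 4) • (innerBilin H (S.ι u) ∘L S.ι).smulRight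
        (innerBilin X (S.B u u) ∘L S.B u)
    + σ • (innerBilin H).bilinearComp S.ι S.ι

lemma Jform_apply (σ : ℝ) (u v w : V) : S.Jform σ u v w = S.J σ u v w := by
  simp [Jform, J, ContinuousLinearMap.bilinearComp_apply]
  ring

lemma norm_B_le (u v : V) : ‖S.B u v‖ ≤ ‖S.B‖ * ‖u‖ * ‖v‖ := S.B.le_opNorm₂ u v

lemma abs_inner_B_le (u v w z : V) :
    |⟪S.B u v, S.B w z⟫| ≤ ‖S.B‖ ^ 2 * (‖u‖ * ‖v‖ * ‖w‖ * ‖z‖) := by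
  refine (abs_real_inner_le_norm _ _).trans ?_
  calc ‖S.B u v‖ * ‖S.B w z‖ ≤ (‖S.B‖ * ‖u‖ * ‖v‖) * (‖S.B‖ * ‖w‖ * ‖z‖) := by
        gcongr <;> exact S.norm_B_le _ _
    _ = _ := by ring

lemma a_nonneg (v : V) : 0 ≤ S.a v v :=
  (mul_nonneg S.α_pos.le (sq_nonneg _)).trans (S.a_coercive v)

lemma a_pos {v : V} (hv : v ≠ 0) : 0 < S.a v v :=
  (mul_pos S.α_pos (pow_pos (norm_pos_iff.2 hv) 2)).trans_le (S.a_coercive v)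

lemma E_nonneg (u : V) : 0 ≤ S.E u := by
  have := S.a_nonneg u
  have := S.κ_nonneg
  unfold E
  positivity

/-- A bound of the `V`-norm on the sublevel set `E ≤ e`. -/
def normBound (e : ℝ) : ℝ := 2 * e / S.α + 1

lemma norm_le_normBound {u : V} {e : ℝ} (hu : S.E u ≤ e) : ‖u‖ ≤ S.normBound e := by
  have h1 := S.a_coercive u
  have hα := S.α_pos
  have h2 : S.α * ‖u‖ ^ 2 ≤ 2 * e := by
    have : 0 ≤ S.κ / 4 * ‖S.B u u‖ ^ 2 := by have := S.κ_nonneg; positivity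
    unfold E at hu
    linarith
  have h3 : ‖u‖ ^ 2 ≤ 2 * e / S.α := by
    rw [le_div_iff₀ hα]; linarith
  unfold normBound
  -- `x ≤ x² + 1` avoids a square root and accounts for the summand `1` in `normBound`.
  nlinarith [sq_nonneg (‖u‖ - 1)]

/-! ### Coercivity of the shifted operator and descent of the energy -/

lemma J_of_norm_one (σ : ℝ) {u : V} (hu : ‖S.ι u‖ = 1) (v w : V) :
    S.J σ u v w = S.a v w + S.κ * (2 * ⟪S.B u v, S.B u w⟫ + ⟪S.B u u, S.B v w⟫)
      - 2 * S.κ * ⟪S.ι u, S.ι v⟫ * ⟪S.B u u, S.B u w⟫ + σ * ⟪S.ι v, S.ι w⟫ := by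
  simp [J, hu]

/-- Homogeneity: `J_σ(u) u = 𝒜(u) + σ u`. -/
lemma J_self (σ : ℝ) {u : V} (hu : ‖S.ι u‖ = 1) (w : V) :
    S.J σ u u w = S.dE u w + σ * ⟪S.ι u, S.ι w⟫ := by
  rw [S.J_of_norm_one σ hu, real_inner_self_eq_norm_sq, hu, dE]
  ring

/-- For shifts `σ ≥ 4/3 E(u)` the operator `J_σ(u)` is at least as coercive as `a`. -/
lemma a_le_J {σ : ℝ} {u : V} (hu : ‖S.ι u‖ = 1) (hσ : 4 / 3 * S.E u ≤ σ) (v : V) :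
    S.a v v ≤ S.J σ u v v := by
  rw [S.J_of_norm_one σ hu, real_inner_self_eq_norm_sq, real_inner_self_eq_norm_sq]
  have h1 := S.B_sq_le u v
  have h2 : |⟪S.ι u, S.ι v⟫| ≤ ‖S.ι v‖ := by
    simpa [hu] using abs_real_inner_le_norm (S.ι u) (S.ι v)
  have h3 := abs_real_inner_le_norm (S.B u u) (S.B u v)
  have h4 : ⟪S.ι u, S.ι v⟫ * ⟪S.B u u, S.B u v⟫ ≤ ‖S.ι v‖ * (‖S.B u u‖ * ‖S.B u v‖) := by
    refine (le_abs_self _).trans ?_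
    rw [abs_mul]
    gcongr
  -- The quartic part of `4/3 E(u)` is `κ/3 ‖B(u, u)‖²`, exactly what completes the square in `h7`.
  have h5 : S.κ / 3 * ‖S.B u u‖ ^ 2 ≤ σ := by
    have := S.a_nonneg u
    unfold E at hσ
    linarith
  have h6 : S.κ / 3 * ‖S.B u u‖ ^ 2 * ‖S.ι v‖ ^ 2 ≤ σ * ‖S.ι v‖ ^ 2 := by gcongr
  -- With `x = ‖B(u, v)‖` and `y = ‖ι v‖ ‖B(u, u)‖` the bracket is at least `3x² - 2xy + y²/3 = (3x
  -- - y)²/3`.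
  have h7 : 0 ≤ S.κ * (2 * ‖S.B u v‖ ^ 2 + ⟪S.B u u, S.B v v⟫
      - 2 * (⟪S.ι u, S.ι v⟫ * ⟪S.B u u, S.B u v⟫) + 1 / 3 * ‖S.B u u‖ ^ 2 * ‖S.ι v‖ ^ 2) := by
    refine mul_nonneg S.κ_nonneg ?_
    nlinarith [sq_nonneg (3 * ‖S.B u v‖ - ‖S.ι v‖ * ‖S.B u u‖)]
  nlinarith

/-- Lax-Milgram for `J_σ(u)`. -/
lemma existsUnique_J [CompleteSpace V] {σ : ℝ} {u : V} (hu : ‖S.ι u‖ = 1)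
    (hσ : 4 / 3 * S.E u ≤ σ) (F : V →L[ℝ] ℝ) : ∃! z : V, ∀ w, S.J σ u z w = F w := by
  have hc : IsCoercive (S.Jform σ u) := by
    refine ⟨S.α, S.α_pos, fun v => ?_⟩
    rw [Jform_apply, mul_assoc, ← sq]
    exact (S.a_coercive v).trans (S.a_le_J hu hσ v)
  set f : V := (InnerProductSpace.toDual ℝ V).symm F
  have hf : ∀ w, ⟪f, w⟫ = F w := fun w => InnerProductSpace.toDual_symm_apply
  refine ⟨hc.continuousLinearEquivOfBilin.symm f, fun w => ?_, fun z hz => ?_⟩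
  · rw [← Jform_apply, ← hc.continuousLinearEquivOfBilin_apply]
    simp [hf]
  · rw [ContinuousLinearEquiv.eq_symm_apply]
    refine ext_inner_right ℝ fun w => ?_
    rw [hc.continuousLinearEquivOfBilin_apply, Jform_apply, hz, hf]

/-- Bilinearity and symmetry of `B` make the energy an exact quartic polynomial along lines, so
descent needs no Taylor remainder theorem. -/
lemma E_add_smul (u v : V) (t : ℝ) :
    S.E (u + t • v) = S.E u + t * S.dE u v
      + t ^ 2 * (1 / 2 * S.a v v + S.κ * (1 / 2 * ⟪S.B u u, S.B v v⟫ + ⟪S.B u v, S.B u v⟫))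
      + t ^ 3 * (S.κ * ⟪S.B u v, S.B v v⟫) + t ^ 4 * (S.κ / 4 * ⟪S.B v v, S.B v v⟫) := by
  have hB : S.B (u + t • v) (u + t • v) = S.B u u + (2 * t) • S.B u v + t ^ 2 • S.B v v := by
    simp only [map_add, map_smul, add_apply, smul_apply,
      S.B_symm v u]
    module
  have ha : S.a (u + t • v) (u + t • v) = S.a u u + 2 * t * S.a u v + t ^ 2 * S.a v v := by
    simp only [map_add, map_smul, add_apply, smul_apply,
      S.a_symm v u, smul_eq_mul]
    ring
  rw [E, E, dE, hB, ha, ← real_inner_self_eq_norm_sq, ← real_inner_self_eq_norm_sq]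
  simp only [inner_add_left, inner_add_right, real_inner_smul_left, real_inner_smul_right]
  rw [real_inner_comm (S.B u u) (S.B u v), real_inner_comm (S.B u u) (S.B v v),
    real_inner_comm (S.B u v) (S.B v v)]
  ring

/-- The homogeneous parts of degree two and four are both nonnegative. Used with the normalization
factor, which is at most one. -/
lemma E_smul_le {v : V} {c : ℝ} (h0 : 0 ≤ c) (h1 : c ≤ 1) : S.E (c • v) ≤ S.E v := by
  have h2 : c ^ 2 ≤ 1 := pow_le_one₀ h0 h1
  have h4 : (c ^ 2) ^ 2 ≤ 1 := pow_le_one₀ (sq_nonneg c) h2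
  have ha := S.a_nonneg v
  have hk : 0 ≤ S.κ / 4 * ‖S.B v v‖ ^ 2 := by have := S.κ_nonneg; positivity
  have : S.E (c • v) = c ^ 2 * (1 / 2 * S.a v v) + (c ^ 2) ^ 2 * (S.κ / 4 * ‖S.B v v‖ ^ 2) := by
    simp only [E, map_smul, smul_apply, smul_eq_mul, norm_smul]
    rw [mul_pow, mul_pow, Real.norm_eq_abs, sq_abs]
    ring
  rw [this, E]
  nlinarith

/-- A bound of the norm of the derivative of the energy on the sublevel set `E ≤ e`. -/
def dEBound (e : ℝ) : ℝ := ‖S.a‖ * S.normBound e + S.κ * (‖S.B‖ ^ 2 * S.normBound e ^ 3)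

lemma normBound_nonneg {u : V} {e : ℝ} (hu : S.E u ≤ e) : 0 ≤ S.normBound e :=
  (norm_nonneg u).trans (S.norm_le_normBound hu)

lemma dEBound_nonneg {u : V} {e : ℝ} (hu : S.E u ≤ e) : 0 ≤ S.dEBound e := by
  have := S.normBound_nonneg hu
  have := S.κ_nonneg
  unfold dEBound
  positivity

lemma abs_inner_B_cubic_le {u : V} {e : ℝ} (hu : S.E u ≤ e) (w : V) :
    |⟪S.B u u, S.B u w⟫| ≤ ‖S.B‖ ^ 2 * S.normBound e ^ 3 * ‖w‖ := by
  have hM := S.norm_le_normBound hu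
  calc |⟪S.B u u, S.B u w⟫| ≤ ‖S.B‖ ^ 2 * (‖u‖ * ‖u‖ * ‖u‖ * ‖w‖) := S.abs_inner_B_le _ _ _ _
    _ = ‖S.B‖ ^ 2 * ‖u‖ ^ 3 * ‖w‖ := by ring
    _ ≤ _ := by gcongr

lemma abs_dE_le {u : V} {e : ℝ} (hu : S.E u ≤ e) (w : V) : |S.dE u w| ≤ S.dEBound e * ‖w‖ := by
  have hM := S.norm_le_normBound hu
  have hκ := S.κ_nonneg
  have h1 : |S.a u w| ≤ ‖S.a‖ * S.normBound e * ‖w‖ := by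
    refine (S.a.le_opNorm₂ u w).trans ?_
    gcongr
  calc |S.dE u w| ≤ |S.a u w| + |S.κ * ⟪S.B u u, S.B u w⟫| := abs_add_le _ _
    _ ≤ ‖S.a‖ * S.normBound e * ‖w‖ + S.κ * (‖S.B‖ ^ 2 * S.normBound e ^ 3 * ‖w‖) := by
        rw [abs_mul, abs_of_nonneg hκ]
        gcongr
        exact S.abs_inner_B_cubic_le hu w
    _ = _ := by unfold dEBound; ring

/-- The constant of the quadratic remainder in the energy expansion on the sublevel set. -/
def remBound (e : ℝ) : ℝ :=
  1 / 2 + S.κ * ‖S.B‖ ^ 2 * (3 / 2 * S.normBound e ^ 2 + S.normBound e * (S.dEBound e / S.α)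
    + 1 / 4 * (S.dEBound e / S.α) ^ 2) / S.α

/-- The step size bound of the energy-diminishing property. -/
def tauMax (e : ℝ) : ℝ := 1 / (2 * S.remBound e)

lemma half_le_remBound {u : V} {e : ℝ} (hu : S.E u ≤ e) : 1 / 2 ≤ S.remBound e := by
  have := S.normBound_nonneg hu
  have := S.dEBound_nonneg hu
  have := S.κ_nonneg
  have := S.α_pos
  have : 0 ≤ S.κ * ‖S.B‖ ^ 2 * (3 / 2 * S.normBound e ^ 2 + S.normBound e * (S.dEBound e / S.α)
    + 1 / 4 * (S.dEBound e / S.α) ^ 2) / S.α := by positivity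
  unfold remBound
  linarith

lemma tauMax_pos {u : V} {e : ℝ} (hu : S.E u ≤ e) : 0 < S.tauMax e := by
  have := S.half_le_remBound hu
  unfold tauMax
  positivity

/-- Along a direction `v` with `a(v, v) ≤ -⟨E'(u), v⟩` the energy decreases for small steps. -/
lemma E_add_smul_le {u v : V} {e t : ℝ} (hu : S.E u ≤ e) (hv : S.a v v ≤ -S.dE u v)
    (ht : 0 < t) (ht' : t ≤ S.tauMax e) :
    S.E (u + t • v) ≤ S.E u - t / 2 * S.a v v := by
  have hM := S.norm_le_normBound hu
  have hM0 := S.normBound_nonneg hu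
  have hD0 := S.dEBound_nonneg hu
  have hκ := S.κ_nonneg
  have hα := S.α_pos
  have hR := S.half_le_remBound hu
  have hR0 : 0 < S.remBound e := by linarith
  have ht1 : t ≤ 1 := by
    refine ht'.trans ?_
    rw [tauMax, div_le_one (by positivity)]
    linarith
  have htR : t * S.remBound e ≤ 1 / 2 := by
    rw [tauMax, le_div_iff₀ (by positivity)] at ht'
    linarith
  set M := S.normBound e
  set C := S.dEBound e / S.α with hC
  have hC0 : 0 ≤ C := by positivity
  -- From `α ‖v‖² ≤ a(v, v) ≤ -⟨E'(u), v⟩`. No shift enters, so the step size bound is independent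
  -- of `σ`.
  have hvC : ‖v‖ ≤ C := by
    rcases eq_or_ne v 0 with rfl | hv0
    · simpa using hC0
    · have h1 := S.a_coercive v
      have h2 := (neg_le_abs _).trans (S.abs_dE_le hu v)
      have h3 : 0 < ‖v‖ := norm_pos_iff.2 hv0
      rw [hC, le_div_iff₀ hα]
      nlinarith
  have hav : ‖v‖ ^ 2 ≤ S.a v v / S.α := by
    rw [le_div_iff₀ hα]; linarith [S.a_coercive v]
  have h1 := (le_abs_self _).trans (S.abs_inner_B_le u u v v)
  have h2 := (le_abs_self _).trans (S.abs_inner_B_le u v u v)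
  have h3 := (le_abs_self _).trans (S.abs_inner_B_le u v v v)
  have h4 := (le_abs_self _).trans (S.abs_inner_B_le v v v v)
  set b := ‖S.B‖ ^ 2 with hb
  have hb0 : 0 ≤ b := by positivity
  have h1' : ⟪S.B u u, S.B v v⟫ ≤ b * M ^ 2 * ‖v‖ ^ 2 :=
    h1.trans (by calc b * (‖u‖ * ‖u‖ * ‖v‖ * ‖v‖) = b * ‖u‖ ^ 2 * ‖v‖ ^ 2 := by ring
                  _ ≤ _ := by gcongr)
  have h2' : ⟪S.B u v, S.B u v⟫ ≤ b * M ^ 2 * ‖v‖ ^ 2 :=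
    h2.trans (by calc b * (‖u‖ * ‖v‖ * ‖u‖ * ‖v‖) = b * ‖u‖ ^ 2 * ‖v‖ ^ 2 := by ring
                  _ ≤ _ := by gcongr)
  have h3' : t * ⟪S.B u v, S.B v v⟫ ≤ b * (M * C) * ‖v‖ ^ 2 := by
    calc t * ⟪S.B u v, S.B v v⟫ ≤ t * (b * (‖u‖ * ‖v‖ * ‖v‖ * ‖v‖)) := by gcongr
      _ ≤ 1 * (b * (‖u‖ * ‖v‖ * ‖v‖ * ‖v‖)) := by gcongr
      _ = b * (‖u‖ * ‖v‖) * ‖v‖ ^ 2 := by ring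
      _ ≤ _ := by gcongr
  have h4' : t ^ 2 * ⟪S.B v v, S.B v v⟫ ≤ b * C ^ 2 * ‖v‖ ^ 2 := by
    calc t ^ 2 * ⟪S.B v v, S.B v v⟫ ≤ t ^ 2 * (b * (‖v‖ * ‖v‖ * ‖v‖ * ‖v‖)) := by gcongr
      _ ≤ 1 * (b * (‖v‖ * ‖v‖ * ‖v‖ * ‖v‖)) := by
          gcongr
          exact pow_le_one₀ ht.le ht1
      _ = b * ‖v‖ ^ 2 * ‖v‖ ^ 2 := by ring
      _ ≤ _ := by gcongr
  -- The terms of order two to four with `t²` factored out; `t ≤ 1` and `‖v‖ ≤ C` reduce each to a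
  -- multiple of `‖v‖²`, and coercivity passes to `a(v, v)`.
  have h5 : 1 / 2 * ⟪S.B u u, S.B v v⟫ + ⟪S.B u v, S.B u v⟫ + t * ⟪S.B u v, S.B v v⟫
      + t ^ 2 * (1 / 4 * ⟪S.B v v, S.B v v⟫)
      ≤ b * (3 / 2 * M ^ 2 + M * C + 1 / 4 * C ^ 2) * (S.a v v / S.α) := by
    calc _ ≤ b * (3 / 2 * M ^ 2 + M * C + 1 / 4 * C ^ 2) * ‖v‖ ^ 2 := by linarith
      _ ≤ _ := by gcongr
  have h6 : 1 / 2 * S.a v v + S.κ * (1 / 2 * ⟪S.B u u, S.B v v⟫ + ⟪S.B u v, S.B u v⟫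
      + t * ⟪S.B u v, S.B v v⟫ + t ^ 2 * (1 / 4 * ⟪S.B v v, S.B v v⟫))
      ≤ S.remBound e * S.a v v := by
    have := mul_le_mul_of_nonneg_left h5 hκ
    calc _ ≤ 1 / 2 * S.a v v
          + S.κ * (b * (3 / 2 * M ^ 2 + M * C + 1 / 4 * C ^ 2) * (S.a v v / S.α)) := by gcongr
      _ = _ := by rw [remBound]; ring
  rw [S.E_add_smul]
  -- The first-order gain is `t a(v, v)`; since `t R ≤ 1/2`, the remainder uses up at most half of
  -- it.
  have h7 := mul_le_mul_of_nonneg_left h6 (sq_nonneg t)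
  have h8 := mul_le_mul_of_nonneg_left hv ht.le
  have h9 : t * (t * S.remBound e * S.a v v) ≤ t * (1 / 2 * S.a v v) := by
    gcongr
    exact S.a_nonneg v
  nlinarith

/-- One damped step: descent of the energy in terms of the search direction. -/
lemma damped_step {σ t e : ℝ} {u z : V} (hu : ‖S.ι u‖ = 1) (he : S.E u ≤ e)
    (hσ : 4 / 3 * e ≤ σ) (ht : 0 < t) (ht' : t ≤ S.tauMax e)
    (hz : ∀ w, S.J σ u z w = ⟪S.ι u, S.ι w⟫) :
    0 < ⟪S.ι z, S.ι u⟫ ∧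
    1 ≤ ‖S.ι ((1 - t) • u + (t * ⟪S.ι z, S.ι u⟫⁻¹) • z)‖ ∧
    S.E (‖S.ι ((1 - t) • u + (t * ⟪S.ι z, S.ι u⟫⁻¹) • z)‖⁻¹ •
      ((1 - t) • u + (t * ⟪S.ι z, S.ι u⟫⁻¹) • z))
      ≤ S.E u - t / 2 * S.a (⟪S.ι z, S.ι u⟫⁻¹ • z - u) (⟪S.ι z, S.ι u⟫⁻¹ • z - u) ∧
    ∀ w, S.J σ u (⟪S.ι z, S.ι u⟫⁻¹ • z - u) w
      = (⟪S.ι z, S.ι u⟫⁻¹ - σ) * ⟪S.ι u, S.ι w⟫ - S.dE u w := by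
  have hσ' : 4 / 3 * S.E u ≤ σ := by linarith
  have hz0 : z ≠ 0 := by
    rintro rfl
    have := hz u
    rw [← Jform_apply, real_inner_self_eq_norm_sq, hu] at this
    simp at this
  have hg : 0 < ⟪S.ι z, S.ι u⟫ := by
    rw [real_inner_comm, ← hz z]
    exact (S.a_pos hz0).trans_le (S.a_le_J hu hσ' z)
  set g := ⟪S.ι z, S.ι u⟫ with hgdef
  set v := g⁻¹ • z - u with hv
  have hJ : ∀ w, S.J σ u v w = (g⁻¹ - σ) * ⟪S.ι u, S.ι w⟫ - S.dE u w := by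
    intro w
    have : S.J σ u v w = g⁻¹ * S.J σ u z w - S.J σ u u w := by
      simp [← Jform_apply, hv]
    rw [this, hz, S.J_self σ hu]
    ring
  -- The normalization `γ = g⁻¹` is chosen exactly for this orthogonality.
  have huv : ⟪S.ι u, S.ι v⟫ = 0 := by
    rw [hv, map_sub, map_smul, inner_sub_right, real_inner_smul_right, real_inner_comm, ← hgdef,
      real_inner_self_eq_norm_sq, hu, inv_mul_cancel₀ hg.ne']
    norm_num
  -- Testing the residual identity with `v` removes the unknown multiplier `γ - σ`.
  have hdir : S.a v v ≤ -S.dE u v := by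
    have := S.a_le_J hu hσ' v
    rw [hJ v, huv] at this
    linarith
  have hw : (1 - t) • u + (t * g⁻¹) • z = u + t • v := by
    rw [hv]; module
  have hn : 1 ≤ ‖S.ι (u + t • v)‖ := by
    rw [← one_le_sq_iff₀ (norm_nonneg _), map_add, map_smul, norm_add_sq_real,
      real_inner_smul_right, huv, hu]
    nlinarith [sq_nonneg ‖t • S.ι v‖]
  rw [hw]
  refine ⟨hg, hn, ?_, hJ⟩
  refine (S.E_smul_le (by positivity) (inv_le_one_of_one_le₀ hn)).trans ?_
  exact S.E_add_smul_le he hdir ht ht'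

/-! ### Compactness of sequences with vanishing residual -/

lemma continuous_E : Continuous S.E := by
  unfold E
  fun_prop

lemma continuous_dE (w : V) : Continuous fun u => S.dE u w := by
  unfold dE
  fun_prop

lemma continuous_dE_self : Continuous fun u => S.dE u u := by
  unfold dE
  fun_prop

/-- Boundedness of `J_σ(u)` on the sublevel set `E ≤ e`. -/
lemma exists_J_bound (σ e : ℝ) : ∃ C, 0 ≤ C ∧ ∀ u v w : V, ‖S.ι u‖ = 1 → S.E u ≤ e →
    |S.J σ u v w| ≤ C * ‖v‖ * ‖w‖ := by
  -- On an empty sublevel set `normBound e` may be negative, so the constant below need not be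
  -- nonnegative.
  by_cases hne : ∃ u, S.E u ≤ e
  swap
  · exact ⟨0, le_rfl, fun u v w _ he => (hne ⟨u, he⟩).elim⟩
  obtain ⟨u₁, hu₁⟩ := hne
  have hM0 := S.normBound_nonneg hu₁
  have hκ := S.κ_nonneg
  refine ⟨‖S.a‖ + S.κ * (3 * (‖S.B‖ ^ 2 * S.normBound e ^ 2))
    + 2 * S.κ * ‖S.ι‖ * (‖S.B‖ ^ 2 * S.normBound e ^ 3) + |σ| * ‖S.ι‖ ^ 2, by positivity, ?_⟩
  intro u v w hu he
  have hM := S.norm_le_normBound he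
  have h1 : |S.a v w| ≤ ‖S.a‖ * ‖v‖ * ‖w‖ := S.a.le_opNorm₂ v w
  have h2 : |⟪S.B u v, S.B u w⟫| ≤ ‖S.B‖ ^ 2 * S.normBound e ^ 2 * ‖v‖ * ‖w‖ := by
    refine (S.abs_inner_B_le u v u w).trans ?_
    calc _ = ‖S.B‖ ^ 2 * ‖u‖ ^ 2 * ‖v‖ * ‖w‖ := by ring
      _ ≤ _ := by gcongr
  have h3 : |⟪S.B u u, S.B v w⟫| ≤ ‖S.B‖ ^ 2 * S.normBound e ^ 2 * ‖v‖ * ‖w‖ := by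
    refine (S.abs_inner_B_le u u v w).trans ?_
    calc _ = ‖S.B‖ ^ 2 * ‖u‖ ^ 2 * ‖v‖ * ‖w‖ := by ring
      _ ≤ _ := by gcongr
  have h4 : |⟪S.ι u, S.ι v⟫ * ⟪S.B u u, S.B u w⟫|
      ≤ (‖S.ι‖ * ‖v‖) * (‖S.B‖ ^ 2 * S.normBound e ^ 3 * ‖w‖) := by
    rw [abs_mul]
    gcongr
    · refine (abs_real_inner_le_norm _ _).trans ?_
      rw [hu, one_mul]
      exact S.ι.le_opNorm v
    · exact S.abs_inner_B_cubic_le he w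
  have h5 : |⟪S.ι v, S.ι w⟫| ≤ (‖S.ι‖ * ‖v‖) * (‖S.ι‖ * ‖w‖) := by
    refine (abs_real_inner_le_norm _ _).trans ?_
    gcongr <;> exact S.ι.le_opNorm _
  rw [S.J_of_norm_one σ hu]
  calc |S.a v w + S.κ * (2 * ⟪S.B u v, S.B u w⟫ + ⟪S.B u u, S.B v w⟫)
      - 2 * S.κ * ⟪S.ι u, S.ι v⟫ * ⟪S.B u u, S.B u w⟫ + σ * ⟪S.ι v, S.ι w⟫|
      ≤ |S.a v w| + S.κ * (2 * |⟪S.B u v, S.B u w⟫| + |⟪S.B u u, S.B v w⟫|)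
        + 2 * S.κ * |⟪S.ι u, S.ι v⟫ * ⟪S.B u u, S.B u w⟫| + |σ| * |⟪S.ι v, S.ι w⟫| := by
        have e1 : |S.κ * (2 * ⟪S.B u v, S.B u w⟫ + ⟪S.B u u, S.B v w⟫)|
            ≤ S.κ * (2 * |⟪S.B u v, S.B u w⟫| + |⟪S.B u u, S.B v w⟫|) := by
          rw [abs_mul, abs_of_nonneg hκ]
          gcongr
          refine (abs_add_le _ _).trans ?_
          rw [abs_mul, abs_two]
        have e2 : |2 * S.κ * ⟪S.ι u, S.ι v⟫ * ⟪S.B u u, S.B u w⟫|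
            = 2 * S.κ * |⟪S.ι u, S.ι v⟫ * ⟪S.B u u, S.B u w⟫| := by
          rw [mul_assoc (2 * S.κ), abs_mul, abs_of_nonneg (by positivity : 0 ≤ 2 * S.κ)]
        rw [← e2, ← abs_mul σ]
        refine (abs_add_le _ _).trans ?_
        gcongr
        refine (abs_sub _ _).trans ?_
        gcongr
        refine (abs_add_le _ _).trans ?_
        gcongr
    _ ≤ ‖S.a‖ * ‖v‖ * ‖w‖ + S.κ * (2 * (‖S.B‖ ^ 2 * S.normBound e ^ 2 * ‖v‖ * ‖w‖)
          + ‖S.B‖ ^ 2 * S.normBound e ^ 2 * ‖v‖ * ‖w‖)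
        + 2 * S.κ * ((‖S.ι‖ * ‖v‖) * (‖S.B‖ ^ 2 * S.normBound e ^ 3 * ‖w‖))
        + |σ| * ((‖S.ι‖ * ‖v‖) * (‖S.ι‖ * ‖w‖)) := by gcongr
    _ = _ := by ring

/-- Compactness of sequences with vanishing residual: a subsequence converges to an
eigenfunction. -/
lemma exists_subseq_tendsto_eigen [CompleteSpace V] {σ e : ℝ} {u v : ℕ → V} {μ : ℕ → ℝ}
    (hu : ∀ n, ‖S.ι (u n)‖ = 1) (he : ∀ n, S.E (u n) ≤ e) (hv : Tendsto v atTop (𝓝 0))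
    (hJ : ∀ n w, S.J σ (u n) (v n) w = μ n * ⟪S.ι (u n), S.ι w⟫ - S.dE (u n) w) :
    ∃ (φ : ℕ → ℕ) (u' : V), StrictMono φ ∧ Tendsto (fun k => u (φ k)) atTop (𝓝 u') ∧
      ‖S.ι u'‖ = 1 ∧ ∀ w, S.dE u' w = S.dE u' u' * ⟪S.ι u', S.ι w⟫ := by
  set M := S.normBound e
  have hM : ∀ n, ‖u n‖ ≤ M := fun n => S.norm_le_normBound (he n)
  have hM0 : 0 ≤ M := (norm_nonneg _).trans (hM 0)
  obtain ⟨C, hC0, hC⟩ := S.exists_J_bound σ e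
  have hκ := S.κ_nonneg
  have hα := S.α_pos
  have hCb := S.Cb_nonneg
  obtain ⟨φ, hφ, hcau⟩ := S.ι_compact u ⟨M, hM⟩
  have hvn : Tendsto (fun n => ‖v n‖) atTop (𝓝 0) := by simpa using hv.norm
  -- The residual identity tested with `u n` itself determines the multiplier, hence its boundedness
  -- and later its limit.
  have hμ : ∀ n, μ n = S.J σ (u n) (v n) (u n) + S.dE (u n) (u n) := by
    intro n
    rw [hJ, real_inner_self_eq_norm_sq, hu]
    ring
  obtain ⟨K, hK⟩ : ∃ K, ∀ n, |μ n| ≤ K := by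
    obtain ⟨b, hb⟩ := hvn.bddAbove_range
    have hb' : ∀ n, ‖v n‖ ≤ b := fun n => hb ⟨n, rfl⟩
    have hD0 := S.dEBound_nonneg (he 0)
    refine ⟨C * b * M + S.dEBound e * M, fun n => ?_⟩
    rw [hμ]
    refine (abs_add_le _ _).trans ?_
    have hb0 : 0 ≤ b := (norm_nonneg _).trans (hb' 0)
    gcongr
    · refine (hC _ _ _ (hu n) (he n)).trans ?_
      gcongr
      · exact hb' n
      · exact hM n
    · refine (S.abs_dE_le (he n) _).trans ?_
      gcongr
      exact hM n
  have hK0 : 0 ≤ K := (abs_nonneg _).trans (hK 0)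
  -- Solving the residual identity for `a`: every term is small in the weak norm of `w` or contains
  -- `v n`; `B_sub` handles the cubic one.
  have ha : ∀ n w, ‖w‖ ≤ 2 * M → |S.a (u n) w|
      ≤ (K + S.κ * (S.Cb * M ^ 3)) * ‖S.ι w‖ + C * (2 * M) * ‖v n‖ := by
    intro n w hw
    have : S.a (u n) w = μ n * ⟪S.ι (u n), S.ι w⟫ - S.J σ (u n) (v n) w
        - S.κ * ⟪S.B (u n) (u n), S.B (u n) w⟫ := by
      rw [hJ, dE]; ring
    rw [this]
    have h1 : |μ n * ⟪S.ι (u n), S.ι w⟫| ≤ K * ‖S.ι w‖ := by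
      rw [abs_mul]
      have := abs_real_inner_le_norm (S.ι (u n)) (S.ι w)
      rw [hu, one_mul] at this
      gcongr
      exact hK n
    have h2 : |S.J σ (u n) (v n) w| ≤ C * (2 * M) * ‖v n‖ := by
      refine (hC _ _ _ (hu n) (he n)).trans ?_
      calc C * ‖v n‖ * ‖w‖ ≤ C * ‖v n‖ * (2 * M) := by gcongr
        _ = _ := by ring
    have h3 : |S.κ * ⟪S.B (u n) (u n), S.B (u n) w⟫| ≤ S.κ * (S.Cb * M ^ 3 * ‖S.ι w‖) := by
      rw [abs_mul, abs_of_nonneg hκ]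
      gcongr
      refine (S.B_sub (u n) w).trans ?_
      gcongr
      exact hM n
    refine (abs_sub _ _).trans ?_
    have := abs_sub (μ n * ⟪S.ι (u n), S.ι w⟫) (S.J σ (u n) (v n) w)
    linarith
  have hcauchy : CauchySeq fun k => u (φ k) := by
    rw [cauchySeq_iff_tendsto_dist_atTop_0]
    set L := K + S.κ * (S.Cb * M ^ 3)
    -- Coercivity at the difference `w`, with `a(w, w)` split into two values controlled by `ha`.
    have hbd : ∀ p : ℕ × ℕ, dist (u (φ p.1)) (u (φ p.2)) ^ 2 ≤
        (2 * L * dist (S.ι (u (φ p.1))) (S.ι (u (φ p.2)))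
          + C * (2 * M) * (‖v (φ p.1)‖ + ‖v (φ p.2)‖)) / S.α := by
      intro p
      set w := u (φ p.1) - u (φ p.2) with hw
      have hwM : ‖w‖ ≤ 2 * M :=
        (norm_sub_le _ _).trans (by linarith [hM (φ p.1), hM (φ p.2)])
      have e1 : S.a w w = S.a (u (φ p.1)) w - S.a (u (φ p.2)) w := by
        have : ∀ x y z, S.a (x - y) z = S.a x z - S.a y z := fun x y z => by simp
        exact this _ _ w
      have e2 := (abs_le.1 (ha (φ p.1) w hwM)).2
      have e3 := (abs_le.1 (ha (φ p.2) w hwM)).1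
      have e4 := S.a_coercive w
      rw [dist_eq_norm, dist_eq_norm, ← map_sub, ← hw, le_div_iff₀ hα]
      linarith
    have hv1 : Tendsto (fun p : ℕ × ℕ => ‖v (φ p.1)‖) atTop (𝓝 0) := by
      rw [← prod_atTop_atTop_eq]
      exact (hvn.comp hφ.tendsto_atTop).comp tendsto_fst
    have hv2 : Tendsto (fun p : ℕ × ℕ => ‖v (φ p.2)‖) atTop (𝓝 0) := by
      rw [← prod_atTop_atTop_eq]
      exact (hvn.comp hφ.tendsto_atTop).comp tendsto_snd
    have hι := cauchySeq_iff_tendsto_dist_atTop_0.1 hcau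
    have hlim := ((hι.const_mul (2 * L)).add
      ((hv1.add hv2).const_mul (C * (2 * M)))).div_const S.α
    simp only [mul_zero, add_zero, zero_div] at hlim
    have hsq := squeeze_zero (fun p => sq_nonneg _) hbd hlim
    have := hsq.sqrt
    simpa [Real.sqrt_sq dist_nonneg] using this
  obtain ⟨u', hu'⟩ := cauchySeq_tendsto_of_complete hcauchy
  -- The alternative covers both uses: the bounded test functions `u n`, and a single fixed `w`.
  have hJ0 : ∀ y : ℕ → V, (∀ n, ‖y n‖ ≤ M ∨ y n = y 0) →
      Tendsto (fun n => S.J σ (u n) (v n) (y n)) atTop (𝓝 0) := by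
    intro y hy
    refine squeeze_zero_norm (a := fun n => C * ‖v n‖ * (M + ‖y 0‖)) (fun n => ?_) ?_
    · refine (hC _ _ _ (hu n) (he n)).trans ?_
      have : ‖y n‖ ≤ M + ‖y 0‖ := by
        rcases hy n with h | h
        · linarith [norm_nonneg (y 0)]
        · rw [h]; linarith
      gcongr
    · simpa using (hvn.const_mul C).mul_const (M + ‖y 0‖)
  have hμlim : Tendsto (fun k => μ (φ k)) atTop (𝓝 (S.dE u' u')) := by
    have h1 := (hJ0 u fun n => Or.inl (hM n)).comp hφ.tendsto_atTop
    have h2 := (S.continuous_dE_self.tendsto u').comp hu'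
    have := h1.add h2
    rw [zero_add] at this
    refine this.congr fun k => ?_
    simp [hμ (φ k)]
  refine ⟨φ, u', hφ, hu', ?_, fun w => ?_⟩
  · have h1 := ((S.ι.continuous.norm).tendsto u').comp hu'
    refine tendsto_nhds_unique h1 ?_
    simp [Function.comp_def, hu]
  · have h1 := (hJ0 (fun _ => w) fun n => Or.inr rfl).comp hφ.tendsto_atTop
    have h2 : Tendsto (fun k => S.dE (u (φ k)) w) atTop (𝓝 (S.dE u' w)) :=
      ((S.continuous_dE w).tendsto u').comp hu'
    have h3 : Tendsto (fun k => ⟪S.ι (u (φ k)), S.ι w⟫) atTop (𝓝 ⟪S.ι u', S.ι w⟫) :=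
      ((S.ι.continuous.tendsto u').comp hu').inner tendsto_const_nhds
    have h4 := (hμlim.mul h3).sub h1
    rw [sub_zero] at h4
    refine tendsto_nhds_unique h2 (h4.congr fun k => ?_)
    simp only [Function.comp_apply]
    rw [hJ]
    ring

/-- `dE u' u'` is the eigenvalue of the limit `u'`, so this yields its positivity. -/
lemma dE_self_pos {u : V} (hu : ‖S.ι u‖ = 1) : 0 < S.dE u u := by
  have hu0 : u ≠ 0 := by
    rintro rfl
    simp at hu
  have h1 := S.a_pos hu0
  have h2 : 0 ≤ S.κ * ⟪S.B u u, S.B u u⟫ := mul_nonneg S.κ_nonneg real_inner_self_nonneg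
  unfold dE
  linarith

end GPForm

/-! ### The Sobolev inequality for test functions -/

namespace GrossPitaevskii
variable {d : ℕ} {D : Set (Space d)}

/-- Cauchy-Schwarz against the constant `1`. -/
lemma lintegral_sq_le {α : Type*} [MeasurableSpace α] (μ : Measure α) {f : α → ℝ≥0∞}
    (hf : AEMeasurable f μ) : (∫⁻ x, f x ∂μ) ^ 2 ≤ μ Set.univ * ∫⁻ x, f x ^ 2 ∂μ := by
  have := ENNReal.lintegral_mul_le_Lp_mul_Lq μ Real.HolderConjugate.two_two hf
    (aemeasurable_const (b := 1))
  simp only [Pi.mul_apply, mul_one, ENNReal.one_rpow, lintegral_const, one_mul] at this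
  refine (pow_le_pow_left' this 2).trans_eq ?_
  rw [mul_pow, ← ENNReal.rpow_natCast, ← ENNReal.rpow_natCast, ← ENNReal.rpow_mul,
    ← ENNReal.rpow_mul]
  norm_num
  rw [mul_comm]

lemma eLpNorm_two_sq {α F : Type*} [MeasurableSpace α] [NormedAddCommGroup F] (μ : Measure α)
    (f : α → F) : eLpNorm f 2 μ ^ 2 = ∫⁻ x, ‖f x‖ₑ ^ 2 ∂μ := by
  have := eLpNorm_nnreal_pow_eq_lintegral (f := f) (μ := μ) (p := 2) two_ne_zero
  simpa using this

/-- The operator norm of the derivative is at most the Euclidean norm of the gradient. -/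
lemma norm_fderiv_le_norm_classicalGrad (φ : Space d → ℂ) (x : Space d) :
    ‖fderiv ℝ φ x‖ ≤ ‖classicalGrad φ x‖ := by
  refine ContinuousLinearMap.opNorm_le_bound _ (norm_nonneg _) fun h => ?_
  have hh : h = ∑ i, h i • EuclideanSpace.single i (1 : ℝ) := by
    ext j
    simp [Finset.sum_apply, Pi.single_apply]
  have h1 : fderiv ℝ φ x h = ∑ i, h i • classicalGrad φ x i := by
    conv_lhs => rw [hh]
    simp [classicalGrad]
  rw [h1, EuclideanSpace.norm_eq, EuclideanSpace.norm_eq]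
  refine (norm_sum_le _ _).trans ?_
  simp only [norm_smul]
  rw [mul_comm]
  exact Real.sum_mul_le_sqrt_mul_sqrt _ _ _

lemma IsTestFunction.continuous_fderiv {φ : Space d → ℂ} (hφ : IsTestFunction D φ) :
    Continuous (fderiv ℝ φ) := hφ.1.continuous_fderiv (by simp)

lemma IsTestFunction.support_subset {φ : Space d → ℂ} (hφ : IsTestFunction D φ) :
    Function.support φ ⊆ D := (subset_tsupport φ).trans hφ.2.2

lemma IsTestFunction.support_fderiv_subset {φ : Space d → ℂ} (hφ : IsTestFunction D φ) :
    Function.support (fderiv ℝ φ) ⊆ D := (_root_.support_fderiv_subset ℝ).trans hφ.2.2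

/-- The `L²`-norm of the derivative of a test function is bounded by that of the gradient. -/
lemma IsTestFunction.eLpNorm_fderiv_le {φ : Space d → ℂ} (hφ : IsTestFunction D φ) :
    eLpNorm (fderiv ℝ φ) 2 volume ≤ eLpNorm (classicalGrad φ) 2 (volume.restrict D) := by
  rw [← eLpNorm_restrict_eq_of_support_subset (f := fderiv ℝ φ) hφ.support_fderiv_subset]
  exact eLpNorm_mono (norm_fderiv_le_norm_classicalGrad φ)

/-- The Sobolev inequality for test functions, in dimensions two and three. -/
lemma exists_sobolev_test (hd : d = 2 ∨ d = 3) (hD : Bornology.IsBounded D) {q : NNReal}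
    (hq0 : 0 < q) (hq : q ≤ 6) : ∃ C : NNReal, ∀ φ : Space d → ℂ, IsTestFunction D φ →
      eLpNorm φ q (volume.restrict D) ≤ C * eLpNorm (classicalGrad φ) 2 (volume.restrict D) := by
  have hfin : volume D ≠ ⊤ := hD.measure_lt_top.ne
  have hqi : (6 : ℝ)⁻¹ ≤ (q : ℝ)⁻¹ := by
    gcongr
    exact_mod_cast hq
  -- Gagliardo-Nirenberg-Sobolev needs `p < d`, which excludes `p = 2` in the plane. There `p = 3/2`
  -- has the critical exponent `6`, as `p = 2` has in dimension three; Hölder on the bounded set `D`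
  -- returns to `L²`.
  obtain ⟨p, hp1, hp2, hpd, hpq⟩ : ∃ p : NNReal, 1 ≤ p ∧ p ≤ 2 ∧ p < (d : NNReal) ∧
      (p : ℝ)⁻¹ - (d : ℝ)⁻¹ ≤ (q : ℝ)⁻¹ := by
    rcases hd with rfl | rfl
    · refine ⟨3 / 2, ?_, ?_, ?_, ?_⟩
      · rw [← NNReal.coe_le_coe]; norm_num
      · rw [← NNReal.coe_le_coe]; norm_num
      · rw [← NNReal.coe_lt_coe]; norm_num
      · refine le_trans ?_ hqi; norm_num
    · refine ⟨2, by norm_num, le_rfl, by norm_num, le_trans ?_ hqi⟩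
      norm_num
  set K := eLpNormLESNormFDerivOfLeConst ℂ (volume : Measure (Space d)) D p q
  set c : ℝ≥0∞ := volume D ^ (1 / (p : ℝ) - 1 / 2)
  have hc : c ≠ ⊤ := by
    refine ENNReal.rpow_ne_top_of_nonneg ?_ hfin
    have h1 : (p : ℝ) ≤ 2 := by exact_mod_cast hp2
    have h2 : (0 : ℝ) < p := by exact_mod_cast zero_lt_one.trans_le hp1
    rw [sub_nonneg]
    gcongr
  refine ⟨K * c.toNNReal, fun φ hφ => ?_⟩
  have h1 : eLpNorm φ q volume ≤ K * eLpNorm (fderiv ℝ φ) p volume :=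
    eLpNorm_le_eLpNorm_fderiv_of_le volume (hφ.1.of_le (by simp)) hφ.support_subset hp1
      (by simpa using hpd) (by simpa using hpq) hD
  have h2 : eLpNorm (fderiv ℝ φ) p (volume.restrict D)
      ≤ eLpNorm (fderiv ℝ φ) 2 (volume.restrict D) * c := by
    have := eLpNorm_le_eLpNorm_mul_rpow_measure_univ (μ := volume.restrict D) (p := p) (q := 2)
      (by exact_mod_cast hp2) hφ.continuous_fderiv.aestronglyMeasurable
    simpa [c] using this
  rw [eLpNorm_restrict_eq_of_support_subset (f := fderiv ℝ φ) hφ.support_fderiv_subset,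
    eLpNorm_restrict_eq_of_support_subset (f := fderiv ℝ φ) hφ.support_fderiv_subset] at h2
  rw [eLpNorm_restrict_eq_of_support_subset hφ.support_subset]
  calc eLpNorm φ q volume ≤ K * eLpNorm (fderiv ℝ φ) p volume := h1
    _ ≤ K * (eLpNorm (classicalGrad φ) 2 (volume.restrict D) * c) := by
        gcongr
        exact h2.trans (by gcongr; exact hφ.eLpNorm_fderiv_le)
    _ = _ := by
        rw [ENNReal.coe_mul, ENNReal.coe_toNNReal hc]
        ring

/-! ### Rellich compactness by averaging over balls -/

/-- The `L²`-modulus of continuity of a test function. -/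
lemma IsTestFunction.lintegral_translate_sub_le {φ : Space d → ℂ} (hφ : IsTestFunction D φ)
    (h : Space d) :
    ∫⁻ x, ‖φ (x + h) - φ x‖ₑ ^ 2 ≤ ‖h‖ₑ ^ 2 * ∫⁻ x, ‖fderiv ℝ φ x‖ₑ ^ 2 := by
  have hc := hφ.continuous_fderiv
  -- The fundamental theorem of calculus on the segment, then Cauchy-Schwarz in `t`. After Tonelli,
  -- translation invariance removes the shift `t • h`.
  have hpt : ∀ x, ‖φ (x + h) - φ x‖ₑ ^ 2
      ≤ ∫⁻ t in Set.Ioc (0 : ℝ) 1, ‖h‖ₑ ^ 2 * ‖fderiv ℝ φ (x + t • h)‖ₑ ^ 2 := by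
    intro x
    have hder : ∀ t : ℝ, HasDerivAt (fun t : ℝ => φ (x + t • h)) (fderiv ℝ φ (x + t • h) h) t := by
      intro t
      have h1 : HasDerivAt (fun t : ℝ => x + t • h) h t := by
        simpa using ((hasDerivAt_id t).smul_const h).const_add x
      exact ((hφ.1.differentiable (by simp)).differentiableAt.hasFDerivAt).comp_hasDerivAt t h1
    have hcont : Continuous fun t : ℝ => fderiv ℝ φ (x + t • h) h := by fun_prop
    have hint : ∫ t in (0 : ℝ)..1, fderiv ℝ φ (x + t • h) h = φ (x + h) - φ x := by
      rw [intervalIntegral.integral_eq_sub_of_hasDerivAt (fun t _ => hder t)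
        (hcont.intervalIntegrable _ _)]
      simp
    rw [← hint, intervalIntegral.integral_of_le zero_le_one]
    refine (pow_le_pow_left' (enorm_integral_le_lintegral_enorm _) 2).trans ?_
    refine (lintegral_sq_le _ hcont.enorm.aemeasurable).trans ?_
    simp only [MeasurableSet.univ, Measure.restrict_apply, Set.univ_inter, Real.volume_Ioc,
      sub_zero, ENNReal.ofReal_one, one_mul]
    gcongr with t
    rw [← mul_pow, mul_comm]
    gcongr
    exact ContinuousLinearMap.le_opENorm _ _
  refine (lintegral_mono hpt).trans ?_
  rw [lintegral_lintegral_swap]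
  · have : ∀ t : ℝ, ∫⁻ x : Space d, ‖h‖ₑ ^ 2 * ‖fderiv ℝ φ (x + t • h)‖ₑ ^ 2
        = ‖h‖ₑ ^ 2 * ∫⁻ x, ‖fderiv ℝ φ x‖ₑ ^ 2 := by
      intro t
      rw [lintegral_const_mul' _ _ (by simp), lintegral_add_right_eq_self
        (fun y => ‖fderiv ℝ φ y‖ₑ ^ 2) (t • h)]
    simp [this]
  · refine Continuous.aemeasurable ?_
    have : Continuous fun p : Space d × ℝ => ‖fderiv ℝ φ (p.1 + p.2 • h)‖ₑ ^ 2 := by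
      refine (ENNReal.continuous_pow 2).comp (Continuous.enorm ?_)
      fun_prop
    exact ENNReal.continuous_const_mul (by simp) |>.comp this

/-- The `L²`-distance of a test function to its averages over balls. -/
lemma IsTestFunction.lintegral_sub_ball_integral_le {φ : Space d → ℂ} (hφ : IsTestFunction D φ)
    {ε : ℝ} (hε : 0 < ε) :
    ∫⁻ x, ‖φ x - (volume.real (Metric.ball (0 : Space d) ε))⁻¹ •
        ∫ y in Metric.ball x ε, φ y‖ₑ ^ 2
      ≤ ENNReal.ofReal ε ^ 2 * ∫⁻ x, ‖fderiv ℝ φ x‖ₑ ^ 2 := by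
  set B := Metric.ball (0 : Space d) ε
  set b := volume.real B with hb
  have hcφ : Continuous φ := hφ.1.continuous
  have hBfin : volume B ≠ ⊤ := Metric.isBounded_ball.measure_lt_top.ne
  have hBpos : volume B ≠ 0 := (Metric.measure_ball_pos _ _ hε).ne'
  have hb0 : b ≠ 0 := by
    rw [hb, measureReal_def, ENNReal.toReal_ne_zero]
    exact ⟨hBpos, hBfin⟩
  have hb1 : ‖b⁻¹‖ₑ = (volume B)⁻¹ := by
    rw [enorm_inv hb0, hb, measureReal_def, Real.enorm_eq_ofReal ENNReal.toReal_nonneg,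
      ENNReal.ofReal_toReal hBfin]
  have htr : ∀ x, ∫ y in Metric.ball x ε, φ y = ∫ h in B, φ (x + h) := by
    intro x
    have e : MeasurePreserving (fun h : Space d => x + h) volume volume :=
      measurePreserving_add_left volume x
    have := e.setIntegral_preimage_emb (measurableEmbedding_addLeft x) φ (Metric.ball x ε)
    rw [← this]
    congr 2
    ext h
    simp [B]
  -- The deviation from the average is an average of translation differences with `‖h‖ < ε`;
  -- Cauchy-Schwarz in `h` moves the square inside.
  have hpt : ∀ x, ‖φ x - b⁻¹ • ∫ y in Metric.ball x ε, φ y‖ₑ ^ 2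
      ≤ (volume B)⁻¹ * ∫⁻ h in B, ‖φ (x + h) - φ x‖ₑ ^ 2 := by
    intro x
    have hi : IntegrableOn (fun h => φ (x + h)) B := by
      refine (Continuous.continuousOn (by fun_prop)).integrableOn_compact
        (isCompact_closedBall (0 : Space d) ε) |>.mono_set Metric.ball_subset_closedBall
    have h1 : φ x - b⁻¹ • ∫ y in Metric.ball x ε, φ y = -(b⁻¹ • ∫ h in B, (φ (x + h) - φ x)) := by
      rw [htr, integral_sub hi (integrableOn_const hBfin), setIntegral_const, smul_sub, smul_smul,
        inv_mul_cancel₀ hb0, one_smul]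
      ring
    rw [h1, enorm_neg, enorm_smul, hb1, mul_pow]
    calc (volume B)⁻¹ ^ 2 * ‖∫ h in B, (φ (x + h) - φ x)‖ₑ ^ 2
        ≤ (volume B)⁻¹ ^ 2 * (volume B * ∫⁻ h in B, ‖φ (x + h) - φ x‖ₑ ^ 2) := by
          gcongr
          refine (pow_le_pow_left' (enorm_integral_le_lintegral_enorm _) 2).trans ?_
          have := lintegral_sq_le (volume.restrict B) (f := fun h => ‖φ (x + h) - φ x‖ₑ)
            (Continuous.aemeasurable (by fun_prop))
          simpa using this
      _ = _ := by
          rw [sq, mul_assoc, ← mul_assoc _ (volume B), ENNReal.inv_mul_cancel hBpos hBfin, one_mul]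
  refine (lintegral_mono hpt).trans ?_
  rw [lintegral_const_mul' _ _ (by simpa using hBpos), lintegral_lintegral_swap]
  · have : ∫⁻ h in B, ∫⁻ x, ‖φ (x + h) - φ x‖ₑ ^ 2
        ≤ ∫⁻ h in B, ENNReal.ofReal ε ^ 2 * ∫⁻ x, ‖fderiv ℝ φ x‖ₑ ^ 2 := by
      refine setLIntegral_mono_ae aemeasurable_const (ae_of_all _ fun h hh => ?_)
      refine (hφ.lintegral_translate_sub_le h).trans ?_
      gcongr
      rw [← ofReal_norm]
      exact ENNReal.ofReal_le_ofReal (by simpa [B] using (Metric.mem_ball.1 hh).le)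
    calc _ ≤ (volume B)⁻¹ * ∫⁻ h in B, ENNReal.ofReal ε ^ 2 * ∫⁻ x, ‖fderiv ℝ φ x‖ₑ ^ 2 := by
          gcongr
      _ = _ := by
        rw [setLIntegral_const, mul_comm _ (volume B), ← mul_assoc,
          ENNReal.inv_mul_cancel hBpos hBfin, one_mul]
  · refine Continuous.aemeasurable ?_
    refine (ENNReal.continuous_pow 2).comp (Continuous.enorm ?_)
    fun_prop

/-- Bounded sequences in `L²` have weakly convergent subsequences, tested with indicators. -/
lemma exists_subseq_tendsto_setIntegral {f : ℕ → L2 D} {M : ℝ} (hf : ∀ n, ‖f n‖ ≤ M) :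
    ∃ (φ : ℕ → ℕ) (g : L2 D), StrictMono φ ∧
      ∀ s : Set (Space d), MeasurableSet s → volume.restrict D s ≠ ⊤ →
      Tendsto (fun n => ∫ x in s, f (φ n) x ∂(volume.restrict D)) atTop
        (𝓝 (∫ x in s, g x ∂(volume.restrict D))) := by
  have : Fact ((2 : ℝ≥0∞) ≠ ⊤) := ⟨by simp⟩
  let F : ℕ → WeakDual ℂ (L2 D) := fun n =>
    StrongDual.toWeakDual (InnerProductSpace.toDual ℂ (L2 D) (f n))
  -- Sequential Banach-Alaoglu in the dual of the separable space `L²`. The Riesz map is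
  -- conjugate-linear, hence the conjugations below.
  obtain ⟨G, -, φ, hφ, hlim⟩ := WeakDual.isSeqCompact_closedBall ℂ (L2 D) 0 M (x := F)
    (fun n => by simpa [F] using hf n)
  refine ⟨φ, (InnerProductSpace.toDual ℂ (L2 D)).symm (WeakDual.toStrongDual G), hφ, ?_⟩
  · intro s hs hsf
    have h1 := ((WeakDual.eval_continuous (indicatorConstLp 2 hs hsf (1 : ℂ))).tendsto G).comp hlim
    have h2 := (Complex.continuous_conj.tendsto _).comp h1
    have key : ∀ g : L2 D, conj (inner ℂ g (indicatorConstLp 2 hs hsf (1 : ℂ)))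
        = ∫ x in s, g x ∂(volume.restrict D) := fun g => by
      rw [inner_conj_symm, L2.inner_indicatorConstLp_one]
    have h3 : conj (G (indicatorConstLp 2 hs hsf (1 : ℂ)))
        = ∫ x in s, (InnerProductSpace.toDual ℂ (L2 D)).symm (WeakDual.toStrongDual G) x
          ∂(volume.restrict D) := by
      rw [← key, InnerProductSpace.toDual_symm_apply]
      rfl
    rw [h3] at h2
    refine h2.congr fun n => ?_
    rw [← key]
    simp [F]

/-- The average over the part of a ball in `D`. -/
def ballAvg (D : Set (Space d)) (ε : ℝ) (f : Space d → ℂ) (x : Space d) : ℂ :=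
  (volume.real (Metric.ball (0 : Space d) ε))⁻¹ • ∫ y in Metric.ball x ε, f y ∂(volume.restrict D)

/-- The average is a parameter integral of `f` against the indicator of the open set `dist y x < ε`
in the product. -/
lemma aestronglyMeasurable_ballAvg (ε : ℝ) {f : Space d → ℂ}
    (hf : AEStronglyMeasurable f (volume.restrict D)) (ν : Measure (Space d)) [SFinite ν] :
    AEStronglyMeasurable (ballAvg D ε f) ν := by
  suffices h : AEStronglyMeasurable
      (fun x => ∫ y in Metric.ball x ε, f y ∂(volume.restrict D)) ν from
    h.const_smul (volume.real (Metric.ball (0 : Space d) ε))⁻¹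
  have hS : MeasurableSet {p : Space d × Space d | dist p.2 p.1 < ε} :=
    (isOpen_lt (by fun_prop) continuous_const).measurableSet
  have h1 : AEStronglyMeasurable (fun p : Space d × Space d =>
      Set.indicator {p : Space d × Space d | dist p.2 p.1 < ε} (fun p => f p.2) p)
      (ν.prod (volume.restrict D)) :=
    (hf.comp_snd).indicator hS
  refine h1.integral_prod_right'.congr (ae_of_all _ fun x => ?_)
  simp only
  rw [← integral_indicator Metric.isOpen_ball.measurableSet]
  rfl

lemma norm_ballAvg_le {ε : ℝ} (hD : Bornology.IsBounded D) (f : L2 D) (x : Space d) :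
    ‖ballAvg D ε f x‖ ≤ (volume.real (Metric.ball (0 : Space d) ε))⁻¹ *
      (√(volume.real D) * ‖f‖) := by
  have hfin : volume D ≠ ⊤ := hD.measure_lt_top.ne
  have : IsFiniteMeasure (volume.restrict D) := ⟨by simpa using hD.measure_lt_top⟩
  have hs : MeasurableSet (Metric.ball x ε) := Metric.isOpen_ball.measurableSet
  have hsf : volume.restrict D (Metric.ball x ε) ≠ ⊤ := measure_ne_top _ _
  rw [ballAvg, norm_smul, norm_inv, Real.norm_of_nonneg measureReal_nonneg]
  gcongr
  rw [← L2.inner_indicatorConstLp_one hs hsf]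
  refine (norm_inner_le_norm _ _).trans ?_
  gcongr
  rw [norm_indicatorConstLp (by simp) (by simp)]
  simp only [norm_one, one_mul, ENNReal.toReal_ofNat]
  rw [← Real.sqrt_eq_rpow]
  gcongr
  rw [measureReal_restrict_apply hs]
  exact measureReal_mono Set.inter_subset_right hfin

/-- An average over a ball is a pairing with an indicator, so weak convergence gives convergence at
every point. The uniform bound `norm_ballAvg_le` dominates, `D` having finite measure. -/
lemma tendsto_eLpNorm_ballAvg {ε : ℝ} (hD : Bornology.IsBounded D) {f : ℕ → L2 D} {g : L2 D}
    {M : ℝ} (hf : ∀ n, ‖f n‖ ≤ M)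
    (h : ∀ s : Set (Space d), MeasurableSet s → volume.restrict D s ≠ ⊤ →
      Tendsto (fun n => ∫ x in s, f n x ∂(volume.restrict D)) atTop
        (𝓝 (∫ x in s, g x ∂(volume.restrict D)))) :
    Tendsto (fun n => eLpNorm (ballAvg D ε (f n) - ballAvg D ε g) 2 (volume.restrict D)) atTop
      (𝓝 0) := by
  have : IsFiniteMeasure (volume.restrict D) := ⟨by simpa using hD.measure_lt_top⟩
  set c := (volume.real (Metric.ball (0 : Space d) ε))⁻¹ * (√(volume.real D) * (M + ‖g‖)) with hc
  have hpt : ∀ x, Tendsto (fun n => ballAvg D ε (f n) x) atTop (𝓝 (ballAvg D ε g x)) := fun x =>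
    (h _ Metric.isOpen_ball.measurableSet (measure_ne_top _ _)).const_smul _
  have hbd : ∀ n x, ‖(ballAvg D ε (f n) - ballAvg D ε g) x‖ ≤ c := by
    intro n x
    refine (norm_sub_le _ _).trans ?_
    refine (add_le_add (norm_ballAvg_le hD (f n) x) (norm_ballAvg_le hD g x)).trans ?_
    rw [hc, ← mul_add, ← mul_add]
    gcongr
    exact hf n
  have hlim : Tendsto (fun n => ∫⁻ x, ‖(ballAvg D ε (f n) - ballAvg D ε g) x‖ₑ ^ 2
      ∂(volume.restrict D)) atTop (𝓝 (∫⁻ x, 0 ∂(volume.restrict D))) := by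
    refine tendsto_lintegral_of_dominated_convergence' (fun _ => ENNReal.ofReal c ^ 2)
      (fun n => ?_) (fun n => ae_of_all _ fun x => ?_) ?_ (ae_of_all _ fun x => ?_)
    · exact (((aestronglyMeasurable_ballAvg ε (Lp.aestronglyMeasurable _) _).sub
        (aestronglyMeasurable_ballAvg ε (Lp.aestronglyMeasurable _) _)).enorm).pow_const 2
    · simp only
      gcongr
      rw [← ofReal_norm]
      exact ENNReal.ofReal_le_ofReal (hbd n x)
    · simp only [lintegral_const]
      exact ENNReal.mul_ne_top (by simp) (measure_ne_top _ _)
    · have h1 := ((hpt x).sub_const (ballAvg D ε g x)).enorm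
      simp only [sub_self, enorm_zero] at h1
      have := ((ENNReal.continuous_pow 2).tendsto 0).comp h1
      simpa [Function.comp_def] using this
  rw [lintegral_zero] at hlim
  have := ((ENNReal.continuous_rpow_const (y := 1 / 2)).tendsto 0).comp hlim
  rw [ENNReal.zero_rpow_of_pos (by norm_num)] at this
  refine this.congr fun n => ?_
  simp only [Function.comp_apply]
  rw [← eLpNorm_two_sq, ← ENNReal.rpow_natCast, ← ENNReal.rpow_mul]
  norm_num

/-- A test function vanishes off `D`, so its averages over the part of a ball in `D` are averages
over the full ball, and the whole-space estimate applies. -/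
lemma IsTestFunction.eLpNorm_sub_ballAvg_le {φ : Space d → ℂ}
    (hφ : IsTestFunction D φ) {ε : ℝ} (hε : 0 < ε) :
    eLpNorm (φ - ballAvg D ε φ) 2 (volume.restrict D)
      ≤ ENNReal.ofReal ε * eLpNorm (classicalGrad φ) 2 (volume.restrict D) := by
  rw [← ENNReal.pow_le_pow_left_iff two_ne_zero, eLpNorm_two_sq, mul_pow]
  have h1 : ∀ x, (φ - ballAvg D ε φ) x = φ x - (volume.real (Metric.ball (0 : Space d) ε))⁻¹ •
        ∫ y in Metric.ball x ε, φ y := by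
    intro x
    rw [Pi.sub_apply, ballAvg, Measure.restrict_restrict Metric.isOpen_ball.measurableSet]
    congr 2
    refine setIntegral_eq_of_subset_of_forall_sdiff_eq_zero
      Metric.isOpen_ball.measurableSet Set.inter_subset_left ?_ |>.symm
    intro y hy
    by_contra hne
    exact hy.2 ⟨hy.1, hφ.support_subset hne⟩
  simp only [h1]
  refine (setLIntegral_le_lintegral _ _).trans ((hφ.lintegral_sub_ball_integral_le hε).trans ?_)
  rw [← eLpNorm_two_sq]
  gcongr
  exact hφ.eLpNorm_fderiv_le

/-- Rellich compactness for sequences of test functions. -/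
lemma exists_subseq_cauchySeq_test (hD : Bornology.IsBounded D)
    {p : ℕ → WithLp 2 (L2 D × L2Vec D)} (hp : ∀ n, p n ∈ testGraph D) {M : ℝ}
    (hM : ∀ n, ‖p n‖ ≤ M) : ∃ φ : ℕ → ℕ, StrictMono φ ∧ CauchySeq fun n => (p (φ n)).fst := by
  have hfst : ∀ n, ‖(p n).fst‖ ≤ M := fun n => (WithLp.norm_fst_le _ _).trans (hM n)
  have hsnd : ∀ n, ‖(p n).snd‖ ≤ M := fun n => (WithLp.norm_snd_le _ _).trans (hM n)
  have hM0 : 0 ≤ M := (norm_nonneg _).trans (hM 0)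
  obtain ⟨φ, g, hφ, hw⟩ := exists_subseq_tendsto_setIntegral hfst
  refine ⟨φ, hφ, Metric.cauchySeq_iff'.2 fun η hη => ?_⟩
  -- The radius is fixed before the index: replacing by averages costs `η/4` uniformly in `n`,
  -- twice, and the averages then contribute `η/8` twice, in total `3η/4 < η`.
  set ε := η / (4 * (M + 1)) with hεdef
  have hε : 0 < ε := by positivity
  set q : ℕ → L2 D := fun n => (p (φ n)).fst with hq
  have happrox : ∀ n, eLpNorm (⇑(q n) - ballAvg D ε (q n)) 2 (volume.restrict D)
      ≤ ENNReal.ofReal (η / 4) := by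
    intro n
    obtain ⟨ψ, hψ, h1, h2⟩ := hp (φ n)
    have e1 : ballAvg D ε (q n) = ballAvg D ε ψ := by
      funext x
      rw [ballAvg, ballAvg]
      congr 1
      exact integral_congr_ae (ae_restrict_of_ae h1)
    rw [e1, eLpNorm_congr_ae (g := ψ - ballAvg D ε ψ) (h1.sub (ae_eq_refl _))]
    refine (hψ.eLpNorm_sub_ballAvg_le hε).trans ?_
    rw [← eLpNorm_congr_ae h2, ← Lp.enorm_def, ← ofReal_norm, ← ENNReal.ofReal_mul hε.le]
    refine ENNReal.ofReal_le_ofReal ?_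
    calc ε * ‖(p (φ n)).snd‖ ≤ ε * (M + 1) := by
          gcongr; linarith [hsnd (φ n)]
      _ = η / 4 := by rw [hεdef]; field_simp
  have hlim := tendsto_eLpNorm_ballAvg (ε := ε) hD (f := q) (fun n => hfst (φ n)) hw
  have hev : ∀ᶠ n in atTop, eLpNorm (ballAvg D ε (q n) - ballAvg D ε g) 2 (volume.restrict D)
      < ENNReal.ofReal (η / 8) :=
    hlim.eventually (gt_mem_nhds (by simpa using hη))
  obtain ⟨N, hN⟩ := eventually_atTop.1 hev
  refine ⟨N, fun n hn => ?_⟩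
  have hm : ∀ k, AEStronglyMeasurable (ballAvg D ε (q k)) (volume.restrict D) := fun k =>
    aestronglyMeasurable_ballAvg ε (Lp.aestronglyMeasurable _) _
  have hmg : AEStronglyMeasurable (ballAvg D ε g) (volume.restrict D) :=
    aestronglyMeasurable_ballAvg ε (Lp.aestronglyMeasurable _) _
  have hmq : ∀ k, AEStronglyMeasurable (q k) (volume.restrict D) := fun k =>
    Lp.aestronglyMeasurable _
  have hdecomp : (⇑(q n) - ⇑(q N)) = ((⇑(q n) - ballAvg D ε (q n))
      - (⇑(q N) - ballAvg D ε (q N))) + ((ballAvg D ε (q n) - ballAvg D ε g)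
      - (ballAvg D ε (q N) - ballAvg D ε g)) := by
    abel
  have hbound : eLpNorm (⇑(q n) - ⇑(q N)) 2 (volume.restrict D)
      < ENNReal.ofReal η := by
    have h12 : (1 : ℝ≥0∞) ≤ 2 := by norm_num
    rw [hdecomp]
    calc _ ≤ (eLpNorm (⇑(q n) - ballAvg D ε (q n)) 2 (volume.restrict D)
            + eLpNorm (⇑(q N) - ballAvg D ε (q N)) 2 (volume.restrict D))
          + (eLpNorm (ballAvg D ε (q n) - ballAvg D ε g) 2 (volume.restrict D)
            + eLpNorm (ballAvg D ε (q N) - ballAvg D ε g) 2 (volume.restrict D)) := by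
          refine (eLpNorm_add_le (((hmq n).sub (hm n)).sub ((hmq N).sub (hm N)))
            (((hm n).sub hmg).sub ((hm N).sub hmg)) h12).trans ?_
          gcongr
          · exact eLpNorm_sub_le ((hmq n).sub (hm n)) ((hmq N).sub (hm N)) h12
          · exact eLpNorm_sub_le ((hm n).sub hmg) ((hm N).sub hmg) h12
      _ ≤ (ENNReal.ofReal (η / 4) + ENNReal.ofReal (η / 4))
          + (ENNReal.ofReal (η / 8) + ENNReal.ofReal (η / 8)) := by
          gcongr
          · exact happrox n
          · exact happrox N
          · exact (hN n hn).le
          · exact (hN N le_rfl).le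
      _ = ENNReal.ofReal (3 * η / 4) := by
          rw [← ENNReal.ofReal_add (by positivity) (by positivity),
            ← ENNReal.ofReal_add (by positivity) (by positivity),
            ← ENNReal.ofReal_add (by positivity) (by positivity)]
          congr 1; ring
      _ < ENNReal.ofReal η := by
          rw [ENNReal.ofReal_lt_ofReal_iff hη]; linarith
  rw [Lp.dist_def]
  exact ENNReal.toReal_lt_of_lt_ofReal hbound

/-- The Rellich theorem: `H¹₀(D)` is compactly embedded in `L²(D)`. -/
lemma exists_subseq_cauchySeq_fst (hD : Bornology.IsBounded D) {v : ℕ → H10 D}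
    {M : ℝ} (hM : ∀ n, ‖v n‖ ≤ M) :
    ∃ φ : ℕ → ℕ, StrictMono φ ∧ CauchySeq fun n => (v (φ n)).1.fst := by
  have happrox : ∀ n : ℕ, ∃ p ∈ testGraph D, dist (v n).1 p < 1 / ((n : ℝ) + 1) := fun n =>
    Metric.mem_closure_iff.1 (v n).2 _ (by positivity)
  choose p hp hdist using happrox
  have hpM : ∀ n, ‖p n‖ ≤ M + 1 := by
    intro n
    have h1 : ‖p n‖ ≤ ‖(v n).1‖ + dist (v n).1 (p n) := by
      rw [dist_comm, dist_eq_norm]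
      have := norm_add_le (v n).1 (p n - (v n).1)
      simpa using this
    have h2 : 1 / ((n : ℝ) + 1) ≤ 1 := by
      rw [div_le_one (by positivity)]
      linarith [Nat.cast_nonneg (α := ℝ) n]
    have h3 : ‖(v n).1‖ ≤ M := hM n
    linarith [hdist n]
  obtain ⟨φ, hφ, hc⟩ := exists_subseq_cauchySeq_test hD hp hpM
  refine ⟨φ, hφ, ?_⟩
  rw [cauchySeq_iff_tendsto_dist_atTop_0] at hc ⊢
  have h0 : Tendsto (fun n : ℕ => 1 / ((φ n : ℝ) + 1)) atTop (𝓝 0) :=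
    tendsto_one_div_add_atTop_nhds_zero_nat.comp hφ.tendsto_atTop
  have h1 : Tendsto (fun k : ℕ × ℕ => 1 / ((φ k.1 : ℝ) + 1)) atTop (𝓝 0) := by
    rw [← prod_atTop_atTop_eq]
    exact h0.comp tendsto_fst
  have h2 : Tendsto (fun k : ℕ × ℕ => 1 / ((φ k.2 : ℝ) + 1)) atTop (𝓝 0) := by
    rw [← prod_atTop_atTop_eq]
    exact h0.comp tendsto_snd
  have hvp : ∀ n, dist (v n).1.fst (p n).fst ≤ 1 / ((n : ℝ) + 1) := fun n => by
    refine le_trans ?_ (hdist n).le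
    rw [dist_eq_norm, dist_eq_norm, ← WithLp.sub_fst]
    exact WithLp.norm_fst_le _ _
  refine squeeze_zero (fun _ => dist_nonneg) (fun k => ?_) 
    (by simpa only [add_zero] using (h1.add hc).add h2)
  refine (dist_triangle4 _ (p (φ k.1)).fst (p (φ k.2)).fst _).trans ?_
  gcongr
  · exact hvp _
  · rw [dist_comm]; exact hvp _

/-! ### Poincaré and Sobolev inequalities on `H¹₀(D)` -/

/-- The Poincaré inequality on `H¹₀(D)`. -/
lemma exists_poincare (hd : d = 2 ∨ d = 3) (hD : Bornology.IsBounded D) :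
    ∃ C : ℝ, 0 ≤ C ∧ ∀ v : H10 D, ‖v.1.fst‖ ≤ C * ‖v.1.snd‖ := by
  obtain ⟨C, hC⟩ := exists_sobolev_test (q := 2) hd hD (by norm_num) (by norm_num)
  refine ⟨C, C.2, fun v => ?_⟩
  have hcl : IsClosed {p : WithLp 2 (L2 D × L2Vec D) | ‖p.fst‖ ≤ C * ‖p.snd‖} :=
    isClosed_le (WithLp.continuous_fst 2 _ _).norm
      (continuous_const.mul (WithLp.continuous_snd 2 _ _).norm)
  refine closure_minimal ?_ hcl v.2
  rintro p ⟨φ, hφ, h1, h2⟩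
  have := hC φ hφ
  rw [Set.mem_ofPred_eq, Lp.norm_def, Lp.norm_def, eLpNorm_congr_ae h1, eLpNorm_congr_ae h2]
  have hfin : eLpNorm (classicalGrad φ) 2 (volume.restrict D) ≠ ⊤ := by
    rw [← eLpNorm_congr_ae h2]
    exact (Lp.memLp _).2.ne
  have h3 := ENNReal.toReal_mono (ENNReal.mul_ne_top (by simp) hfin) this
  simpa using h3

/-- The Sobolev embedding of `H¹₀(D)` in `L^q(D)`, `q ≤ 6`. -/
lemma exists_eLpNorm_fn_le (hd : d = 2 ∨ d = 3) (hD : Bornology.IsBounded D) {q : NNReal}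
    (hq0 : 0 < q) (hq : q ≤ 6) :
    ∃ C : NNReal, ∀ v : H10 D, eLpNorm (fn v) q (volume.restrict D) ≤ C * ‖v‖ₑ := by
  obtain ⟨C, hC⟩ := exists_sobolev_test hd hD hq0 hq
  refine ⟨C, fun v => ?_⟩
  obtain ⟨p, hp, hlim⟩ := mem_closure_iff_seq_limit.1 v.2
  have hpb : ∀ n, eLpNorm (p n).fst q (volume.restrict D) ≤ C * ‖p n‖ₑ := by
    intro n
    obtain ⟨φ, hφ, h1, h2⟩ := hp n
    rw [eLpNorm_congr_ae h1]
    refine (hC φ hφ).trans ?_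
    gcongr
    rw [← eLpNorm_congr_ae h2, ← Lp.enorm_def, ← ofReal_norm, ← ofReal_norm]
    exact ENNReal.ofReal_le_ofReal (WithLp.norm_snd_le _ _)
  have hfst : Tendsto (fun n => (p n).fst) atTop (𝓝 v.1.fst) :=
    ((WithLp.continuous_fst 2 _ _).tendsto _).comp hlim
  -- Approximation by test functions holds only in `H¹`; an a.e. convergent subsequence and Fatou
  -- carry the `L^q` bound to the limit.
  obtain ⟨ψ, hψ, hae⟩ := (tendstoInMeasure_of_tendsto_Lp hfst).exists_seq_tendsto_ae
  have hfatou := Lp.eLpNorm_lim_le_liminf_eLpNorm (p := q)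
    (fun n => Lp.aestronglyMeasurable (p (ψ n)).fst) (fn v) hae
  refine hfatou.trans ?_
  have hl : Tendsto (fun n => (C : ℝ≥0∞) * ‖p (ψ n)‖ₑ) atTop (𝓝 (C * ‖v‖ₑ)) :=
    ENNReal.Tendsto.const_mul ((hlim.comp hψ.tendsto_atTop).enorm) (Or.inr (by simp))
  rw [← hl.liminf_eq]
  exact liminf_le_liminf (Eventually.of_forall fun n => hpb (ψ n))

/-! ### Real Hilbert space structure and multiplication operators -/

/-- The real part of the `H¹` inner product. -/
instance : InnerProductSpace ℝ (H10 D) where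
  toNormedSpace := (H10 D).normedSpace
  inner v w := (inner ℂ v w).re
  norm_sq_eq_re_inner v := norm_sq_eq_re_inner (𝕜 := ℂ) v
  conj_inner_symm v w := (InnerProductSpace.rclikeToReal ℂ (H10 D)).conj_inner_symm v w
  add_left v w z := (InnerProductSpace.rclikeToReal ℂ (H10 D)).add_left v w z
  smul_left v w r := (InnerProductSpace.rclikeToReal ℂ (H10 D)).smul_left v w r

instance : CompleteSpace (H10 D) :=
  (Submodule.isClosed_topologicalClosure (testGraph D)).completeSpace_coe

lemma norm_sq_H10 (v : H10 D) : ‖v‖ ^ 2 = ‖v.1.fst‖ ^ 2 + ‖v.1.snd‖ ^ 2 :=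
  WithLp.prod_norm_sq_eq_of_L2 v.1

/-- The embedding `H¹₀(D) → L²(D)`. -/
def fstMap (D : Set (Space d)) : H10 D →L[ℝ] L2 D :=
  LinearMap.mkContinuous
    { toFun := fun v => v.1.fst, map_add' := fun _ _ => rfl, map_smul' := fun _ _ => rfl } 1
    fun v => by rw [one_mul]; exact WithLp.norm_fst_le _ v.1

/-- The weak gradient as a map `H¹₀(D) → L²(D; ℂᵈ)`. -/
def sndMap (D : Set (Space d)) : H10 D →L[ℝ] L2Vec D :=
  LinearMap.mkContinuous
    { toFun := fun v => v.1.snd, map_add' := fun _ _ => rfl, map_smul' := fun _ _ => rfl } 1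
    fun v => by rw [one_mul]; exact WithLp.norm_snd_le _ v.1

@[simp] lemma fstMap_apply (v : H10 D) : fstMap D v = v.1.fst := rfl

@[simp] lemma sndMap_apply (v : H10 D) : sndMap D v = v.1.snd := rfl

section Multiplication

variable {F : Type*} [NormedAddCommGroup F] [NormedSpace ℂ F]

lemma memLp_smul_bounded {q : Space d → F} {K : ℝ}
    (hq : AEStronglyMeasurable q (volume.restrict D))
    (hK : ∀ᵐ x ∂(volume.restrict D), ‖q x‖ ≤ K) (f : L2 D) :
    MemLp (fun x => f x • q x) 2 (volume.restrict D) := by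
  refine (Lp.memLp f).of_le_mul (c := K) ((Lp.aestronglyMeasurable f).smul hq) ?_
  filter_upwards [hK] with x hx
  rw [norm_smul, mul_comm]
  gcongr

/-- Multiplication of `L²`-functions with a bounded function. -/
def smulBounded {q : Space d → F} {K : ℝ} (hq : AEStronglyMeasurable q (volume.restrict D))
    (hK : ∀ᵐ x ∂(volume.restrict D), ‖q x‖ ≤ K) : L2 D →L[ℝ] Lp F 2 (volume.restrict D) :=
  LinearMap.mkContinuous
    { toFun := fun f => (memLp_smul_bounded hq hK f).toLp
      map_add' := fun f g => by
        rw [← MemLp.toLp_add]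
        refine MemLp.toLp_congr _ _ ?_
        filter_upwards [Lp.coeFn_add f g] with x hx
        rw [hx, Pi.add_apply, add_smul, Pi.add_apply]
      map_smul' := fun r f => by
        rw [RingHom.id_apply, ← MemLp.toLp_const_smul]
        refine MemLp.toLp_congr _ _ ?_
        filter_upwards [Lp.coeFn_smul r f] with x hx
        rw [hx, Pi.smul_apply, Pi.smul_apply, smul_assoc] } K
    fun f => by
      refine Lp.norm_le_mul_norm_of_ae_le_mul ?_
      filter_upwards [hK, (memLp_smul_bounded hq hK f).coeFn_toLp] with x hx h1
      simp only [LinearMap.coe_mk, AddHom.coe_mk]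
      rw [h1, norm_smul, mul_comm]
      gcongr

lemma coeFn_smulBounded {q : Space d → F} {K : ℝ}
    (hq : AEStronglyMeasurable q (volume.restrict D))
    (hK : ∀ᵐ x ∂(volume.restrict D), ‖q x‖ ≤ K) (f : L2 D) :
    smulBounded hq hK f =ᵐ[volume.restrict D] fun x => f x • q x :=
  (memLp_smul_bounded hq hK f).coeFn_toLp

end Multiplication

/-- The vector field `i (Ω/2) R(x)`. -/
def rotVec (d : ℕ) (Ω : ℝ) (x : Space d) : CVec d :=
  WithLp.toLp 2 fun i => Complex.I * (Ω / 2) * (rotField x i : ℂ)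

lemma continuous_coord (k : ℕ) : Continuous fun x : Space d => coord x k := by
  unfold coord
  split_ifs <;> fun_prop

lemma continuous_rotVec (Ω : ℝ) : Continuous (rotVec d Ω) := by
  refine (PiLp.continuous_toLp 2 _).comp (continuous_pi fun i => ?_)
  refine continuous_const.mul (Complex.continuous_ofReal.comp ?_)
  unfold rotField
  have h0 := continuous_coord (d := d) 0
  have h1 := continuous_coord (d := d) 1
  split_ifs <;> fun_prop

/-- `R(x)` is a rotation of the projection of `x` to its first two coordinates. -/
lemma norm_rotVec_le (hd : d = 2 ∨ d = 3) (Ω : ℝ) (x : Space d) :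
    ‖rotVec d Ω x‖ ≤ |Ω| / 2 * ‖x‖ := by
  have h : ‖rotVec d Ω x‖ ^ 2 ≤ (|Ω| / 2 * ‖x‖) ^ 2 := by
    rw [mul_pow, EuclideanSpace.norm_sq_eq, EuclideanSpace.norm_sq_eq]
    have e : ∀ i, ‖rotVec d Ω x i‖ ^ 2 = (|Ω| / 2) ^ 2 * rotField x i ^ 2 := fun i => by
      simp [rotVec, mul_pow]
    simp only [e, ← Finset.mul_sum]
    refine mul_le_mul_of_nonneg_left ?_ (by positivity)
    rcases hd with rfl | rfl
    · simp [Fin.sum_univ_two, rotField, coord]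
      linarith
    · simp [Fin.sum_univ_three, rotField, coord]
      nlinarith [sq_nonneg (x 2)]
  exact le_of_sq_le_sq h (by positivity)

lemma rotGrad_eq (Ω : ℝ) (v : H10 D) (x : Space d) :
    rotGrad Ω v x = grad v x + fn v x • rotVec d Ω x := by
  ext i
  simp only [rotGrad, rotVec, PiLp.add_apply, PiLp.smul_apply, smul_eq_mul]
  ring

/-- Connects the real inner products of the abstract setting with the real parts of complex
integrals in the definitions. -/
lemma real_inner_L2_eq_re {F : Type*} [NormedAddCommGroup F] [InnerProductSpace ℝ F]
    [InnerProductSpace ℂ F] (h : ∀ x y : F, inner ℝ x y = (inner ℂ x y).re)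
    (f g : Lp F 2 (volume.restrict D)) : inner ℝ f g = (inner ℂ f g).re := by
  rw [L2.inner_def, L2.inner_def]
  simp only [h]
  exact integral_re (𝕜 := ℂ) (L2.integrable_inner f g)

lemma real_inner_complex_eq_re (x y : ℂ) : inner ℝ x y = (inner ℂ x y).re := by
  simp [Complex.inner, RCLike.inner_apply]

lemma real_inner_CVec_eq_re (x y : CVec d) : inner ℝ x y = (inner ℂ x y).re := by
  simp only [PiLp.inner_apply, real_inner_complex_eq_re, Complex.re_sum]

lemma hInner_eq (v w : H10 D) : hInner v w = inner ℝ (fstMap D v) (fstMap D w) := by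
  rw [real_inner_comm, real_inner_L2_eq_re real_inner_complex_eq_re, L2.inner_def]
  rfl

/-! ### The quadratic part of the energy -/

lemma ae_norm_le_of_bounded {q : Space d → ℝ} {W : Space d → ℝ}
    (hW : MemLp W ⊤ (volume.restrict D)) {c : ℝ}
    (h : ∀ᵐ x ∂(volume.restrict D), |q x| ≤ |W x| + c) :
    ∃ K, ∀ᵐ x ∂(volume.restrict D), ‖((q x : ℝ) : ℂ)‖ ≤ K := by
  refine ⟨(eLpNormEssSup W (volume.restrict D)).toReal + c, ?_⟩
  have hfin : eLpNormEssSup W (volume.restrict D) ≠ ⊤ := by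
    rw [← eLpNorm_exponent_top]
    exact hW.2.ne
  filter_upwards [h, ae_le_eLpNormEssSup (f := W) (μ := volume.restrict D)] with x hx h1
  have h2 := ENNReal.toReal_mono hfin h1
  simp only [toReal_enorm, Real.norm_eq_abs] at h2
  simp only [Complex.norm_real, Real.norm_eq_abs]
  linarith

lemma exists_rotPotential_bound (hDm : MeasurableSet D) (hD : Bornology.IsBounded D)
    {W : Space d → ℝ} (hW : MemLp W ⊤ (volume.restrict D)) (Ω : ℝ) :
    ∃ K, ∀ᵐ x ∂(volume.restrict D), ‖((rotPotential W Ω x : ℝ) : ℂ)‖ ≤ K := by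
  obtain ⟨ρ, hρ⟩ := hD.exists_norm_le
  refine ae_norm_le_of_bounded hW (c := 1 / 4 * Ω ^ 2 * ρ ^ 2) ?_
  filter_upwards [ae_restrict_mem hDm] with x hx
  have h1 := hρ x hx
  unfold rotPotential
  refine (abs_sub _ _).trans ?_
  gcongr
  rw [abs_of_nonneg (by positivity)]
  gcongr

lemma aestronglyMeasurable_rotPotential {W : Space d → ℝ}
    (hW : MemLp W ⊤ (volume.restrict D)) (Ω : ℝ) :
    AEStronglyMeasurable (fun x => ((rotPotential W Ω x : ℝ) : ℂ)) (volume.restrict D) := by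
  refine Complex.continuous_ofReal.comp_aestronglyMeasurable ?_
  unfold rotPotential
  exact hW.1.sub (Continuous.aestronglyMeasurable (by fun_prop))

/-- The rotational gradient as a bounded map `H¹₀(D) → L²(D; ℂᵈ)`. -/
lemma exists_rotGrad_map (hd : d = 2 ∨ d = 3) (hDm : MeasurableSet D)
    (hD : Bornology.IsBounded D) (Ω : ℝ) :
    ∃ T : H10 D →L[ℝ] L2Vec D, ∀ v, T v =ᵐ[volume.restrict D] rotGrad Ω v := by
  obtain ⟨ρ, hρ⟩ := hD.exists_norm_le
  have hrot : ∀ᵐ x ∂(volume.restrict D), ‖rotVec d Ω x‖ ≤ |Ω| / 2 * ρ := by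
    filter_upwards [ae_restrict_mem hDm] with x hx
    refine (norm_rotVec_le hd Ω x).trans ?_
    gcongr
    exact hρ x hx
  refine ⟨sndMap D + smulBounded (continuous_rotVec Ω).aestronglyMeasurable hrot ∘L fstMap D,
    fun v => ?_⟩
  have h1 := coeFn_smulBounded (continuous_rotVec Ω).aestronglyMeasurable hrot (fstMap D v)
  filter_upwards [h1, Lp.coeFn_add (sndMap D v)
    (smulBounded (continuous_rotVec Ω).aestronglyMeasurable hrot (fstMap D v))] with x hx h2
  rw [add_apply, ContinuousLinearMap.comp_apply, h2, Pi.add_apply, hx, rotGrad_eq]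
  rfl

/-- Multiplication with the potential as a bounded map `H¹₀(D) → L²(D)`. -/
lemma exists_rotPotential_map (hDm : MeasurableSet D) (hD : Bornology.IsBounded D)
    {W : Space d → ℝ} (hW : MemLp W ⊤ (volume.restrict D)) (Ω : ℝ) :
    ∃ P : H10 D →L[ℝ] L2 D, ∀ v, P v =ᵐ[volume.restrict D]
      fun x => ((rotPotential W Ω x : ℝ) : ℂ) * fn v x := by
  obtain ⟨K, hK⟩ := exists_rotPotential_bound hDm hD hW Ω
  refine ⟨smulBounded (aestronglyMeasurable_rotPotential hW Ω) hK ∘L fstMap D, fun v => ?_⟩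
  filter_upwards [coeFn_smulBounded (aestronglyMeasurable_rotPotential hW Ω) hK (fstMap D v)]
    with x hx
  rw [ContinuousLinearMap.comp_apply, hx, smul_eq_mul, mul_comm]
  rfl

/-- The real part of the linear form is a bounded, symmetric and coercive bilinear form. -/
lemma exists_linearForm_bilin (hd : d = 2 ∨ d = 3) (hDm : MeasurableSet D)
    (hD : Bornology.IsBounded D) {W : Space d → ℝ} (hW : MemLp W ⊤ (volume.restrict D)) (Ω : ℝ)
    (hWΩ : ∀ᵐ x ∂(volume.restrict D), Ω ^ 2 * ‖x‖ ^ 2 ≤ W x) :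
    ∃ (a : H10 D →L[ℝ] H10 D →L[ℝ] ℝ) (α : ℝ), 0 < α ∧
      (∀ v w, a v w = (linearForm W Ω v w).re) ∧ (∀ v w, a v w = a w v) ∧
      (∀ v, α * ‖v‖ ^ 2 ≤ a v v) ∧
      (∀ v : H10 D, Integrable (fun x => ‖rotGrad Ω v x‖ ^ 2 + rotPotential W Ω x * ‖fn v x‖ ^ 2)
        (volume.restrict D)) ∧
      ∀ v, a v v = ∫ x in D, (‖rotGrad Ω v x‖ ^ 2 + rotPotential W Ω x * ‖fn v x‖ ^ 2) := by
  obtain ⟨T, hTc⟩ := exists_rotGrad_map hd hDm hD Ω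
  obtain ⟨P, hPc⟩ := exists_rotPotential_map hDm hD hW Ω
  have hpt : ∀ v w, (fun x => inner ℂ (T w x) (T v x) + inner ℂ (fstMap D w x) (P v x))
      =ᵐ[volume.restrict D] fun x => (∑ i, rotGrad Ω v x i * conj (rotGrad Ω w x i))
        + (rotPotential W Ω x : ℂ) * fn v x * conj (fn w x) := by
    intro v w
    filter_upwards [hTc v, hTc w, hPc v] with x h1 h2 h3
    rw [h1, h2, h3, PiLp.inner_apply]
    rfl
  have hint : ∀ v w, Integrable (fun x => inner ℂ (T w x) (T v x)
      + inner ℂ (fstMap D w x) (P v x)) (volume.restrict D) := fun v w =>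
    (L2.integrable_inner (T w) (T v)).add (L2.integrable_inner (fstMap D w) (P v))
  have hlin : ∀ v w, linearForm W Ω v w = inner ℂ (T w) (T v) + inner ℂ (fstMap D w) (P v) := by
    intro v w
    rw [linearForm, ← integral_congr_ae (hpt v w), integral_add (L2.integrable_inner _ _)
      (L2.integrable_inner _ _), L2.inner_def, L2.inner_def]
  have hlin' : ∀ v w, inner ℝ (T v) (T w) + inner ℝ (P v) (fstMap D w)
      = (linearForm W Ω v w).re := by
    intro v w
    rw [hlin, Complex.add_re, ← real_inner_L2_eq_re real_inner_CVec_eq_re,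
      ← real_inner_L2_eq_re real_inner_complex_eq_re, real_inner_comm,
      real_inner_comm (P v)]
  obtain ⟨a, ha⟩ : ∃ a : H10 D →L[ℝ] H10 D →L[ℝ] ℝ, ∀ v w,
      a v w = inner ℝ (T v) (T w) + inner ℝ (P v) (fstMap D w) :=
    ⟨(GPForm.innerBilin (L2Vec D)).bilinearComp T T
      + (GPForm.innerBilin (L2 D)).bilinearComp P (fstMap D), fun v w => rfl⟩
  have haform : ∀ v w, a v w = (linearForm W Ω v w).re := fun v w => by rw [ha, hlin']
  have hre : ∀ (v : H10 D) (x : Space d), ((∑ i, rotGrad Ω v x i * conj (rotGrad Ω v x i))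
      + (rotPotential W Ω x : ℂ) * fn v x * conj (fn v x))
      = ((‖rotGrad Ω v x‖ ^ 2 + rotPotential W Ω x * ‖fn v x‖ ^ 2 : ℝ) : ℂ) := by
    intro v x
    rw [EuclideanSpace.norm_sq_eq, mul_assoc]
    simp only [Complex.mul_conj, Complex.normSq_eq_norm_sq]
    push_cast
    rfl
  have hintre : ∀ v : H10 D, Integrable
      (fun x => ‖rotGrad Ω v x‖ ^ 2 + rotPotential W Ω x * ‖fn v x‖ ^ 2)
      (volume.restrict D) := by
    intro v
    have := ((hint v v).congr (hpt v v)).re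
    simpa only [hre, RCLike.re_to_complex, Complex.ofReal_re] using this
  have hdiag : ∀ v, a v v = ∫ x in D, (‖rotGrad Ω v x‖ ^ 2
      + rotPotential W Ω x * ‖fn v x‖ ^ 2) := by
    intro v
    rw [haform, linearForm]
    simp only [hre]
    rw [integral_complex_ofReal, Complex.ofReal_re]
  obtain ⟨C, hC0, hC⟩ := exists_poincare hd hD
  have arith : ∀ {f g b : ℝ}, f ≤ C ^ 2 * g → 3 / 4 * g ≤ b →
      3 / 4 * (f + g) ≤ b * (C ^ 2 + 1) := by
    intro f g b h1 h2
    calc 3 / 4 * (f + g) ≤ 3 / 4 * (C ^ 2 * g + g) := by gcongr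
      _ = 3 / 4 * g * (C ^ 2 + 1) := by ring
      _ ≤ b * (C ^ 2 + 1) := by gcongr
  refine ⟨a, 3 / 4 / (C ^ 2 + 1), by positivity, haform, ?_, ?_, hintre, hdiag⟩
  · intro v w
    have hsym : inner ℝ (P v) (fstMap D w) = inner ℝ (P w) (fstMap D v) := by
      rw [L2.inner_def, L2.inner_def]
      refine integral_congr_ae ?_
      filter_upwards [hPc v, hPc w] with x h1 h2
      rw [h1, h2]
      simp only [Complex.inner, map_mul, Complex.conj_ofReal, fstMap_apply]
      simp [fn]
      ring
    rw [ha, ha, real_inner_comm, hsym]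
  · intro v
    -- Put `p = |∇_R v|` and `q = |v| |rotVec|`. Since `W ≥ Ω²|x|²`, the potential `W_R` is at least
    -- `3 |rotVec|²`, and `p² + 3q² - 3/4 (p + q)² = (p - 3q)²/4`. Poincaré then adds the `L²`-part
    -- of the norm.
    have hgrad : 3 / 4 * ‖v.1.snd‖ ^ 2 ≤ a v v := by
      rw [hdiag, ← real_inner_self_eq_norm_sq, L2.inner_def, ← integral_const_mul]
      refine integral_mono_ae ((L2.integrable_inner _ _).const_mul _) (hintre v) ?_
      filter_upwards [hWΩ] with x hx
      have h1 := norm_rotVec_le hd Ω x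
      have h2 : ‖grad v x‖ ≤ ‖rotGrad Ω v x‖ + ‖fn v x‖ * ‖rotVec d Ω x‖ := by
        have : grad v x = rotGrad Ω v x - fn v x • rotVec d Ω x := by
          rw [rotGrad_eq, add_sub_cancel_right]
        rw [this, ← norm_smul]
        exact norm_sub_le _ _
      have h3 : ‖rotVec d Ω x‖ ^ 2 ≤ Ω ^ 2 / 4 * ‖x‖ ^ 2 := by
        calc ‖rotVec d Ω x‖ ^ 2 ≤ (|Ω| / 2 * ‖x‖) ^ 2 := by gcongr
          _ = _ := by rw [mul_pow, div_pow, sq_abs]; norm_num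
      have h4 : 3 * ‖rotVec d Ω x‖ ^ 2 ≤ rotPotential W Ω x := by
        unfold rotPotential
        linarith
      have h5 : 3 * ‖rotVec d Ω x‖ ^ 2 * ‖fn v x‖ ^ 2 ≤ rotPotential W Ω x * ‖fn v x‖ ^ 2 := by
        gcongr
      have h6 : ‖grad v x‖ ^ 2 ≤ (‖rotGrad Ω v x‖ + ‖fn v x‖ * ‖rotVec d Ω x‖) ^ 2 := by gcongr
      change 3 / 4 * inner ℝ (grad v x) (grad v x) ≤ _
      rw [real_inner_self_eq_norm_sq]
      nlinarith [sq_nonneg (‖rotGrad Ω v x‖ - 3 * (‖fn v x‖ * ‖rotVec d Ω x‖))]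
    have h7 : ‖v.1.fst‖ ^ 2 ≤ C ^ 2 * ‖v.1.snd‖ ^ 2 := by
      rw [← mul_pow]
      gcongr
      exact hC v
    rw [norm_sq_H10, div_mul_eq_mul_div, div_le_iff₀ (by positivity)]
    exact arith h7 hgrad

/-! ### The quartic part of the energy -/

lemma aestronglyMeasurable_fn (v : H10 D) : AEStronglyMeasurable (fn v) (volume.restrict D) :=
  Lp.aestronglyMeasurable v.1.fst

lemma fn_add (v w : H10 D) : fn (v + w) =ᵐ[volume.restrict D] fn v + fn w :=
  Lp.coeFn_add v.1.fst w.1.fst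

lemma fn_smul (r : ℝ) (v : H10 D) : fn (r • v) =ᵐ[volume.restrict D] r • fn v :=
  Lp.coeFn_smul r v.1.fst

lemma holderTriple_four_four_two : ENNReal.HolderTriple 4 4 2 := ⟨by
  rw [← two_mul, show (4 : ℝ≥0∞) = 2 * 2 by norm_num, ENNReal.mul_inv (by simp) (by simp),
    ← mul_assoc, ENNReal.mul_inv_cancel (by simp) (by simp), one_mul]⟩

/-- The pointwise real product `Re(u v̄)`. -/
def reProd (u v : H10 D) (x : Space d) : ℝ := (fn u x * conj (fn v x)).re

lemma aestronglyMeasurable_reProd (u v : H10 D) :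
    AEStronglyMeasurable (reProd u v) (volume.restrict D) :=
  Complex.continuous_re.comp_aestronglyMeasurable ((aestronglyMeasurable_fn u).mul
    (Complex.continuous_conj.comp_aestronglyMeasurable (aestronglyMeasurable_fn v)))

lemma abs_reProd_le (u v : H10 D) (x : Space d) : |reProd u v x| ≤ ‖fn u x‖ * ‖fn v x‖ := by
  refine (Complex.abs_re_le_norm _).trans_eq ?_
  rw [norm_mul, RCLike.norm_conj]

lemma reProd_self (u : H10 D) (x : Space d) : reProd u u x = ‖fn u x‖ ^ 2 := by
  rw [reProd, Complex.mul_conj, Complex.ofReal_re, Complex.normSq_eq_norm_sq]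

lemma reProd_comm (u v : H10 D) (x : Space d) : reProd u v x = reProd v u x := by
  simp [reProd]
  ring

lemma eLpNorm_reProd_le (u v : H10 D) : eLpNorm (reProd u v) 2 (volume.restrict D)
    ≤ eLpNorm (fn u) 4 (volume.restrict D) * eLpNorm (fn v) 4 (volume.restrict D) := by
  have := holderTriple_four_four_two
  have h := eLpNorm_le_eLpNorm_mul_eLpNorm_of_nnnorm (p := 4) (q := 4) (r := 2)
    (aestronglyMeasurable_fn u) (aestronglyMeasurable_fn v)
    (fun z w : ℂ => (z * conj w).re) 1 (ae_of_all _ fun x => by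
      rw [one_mul, ← NNReal.coe_le_coe]
      exact abs_reProd_le u v x)
  rwa [ENNReal.coe_one, one_mul] at h

lemma exists_eLpNorm_four_le (hd : d = 2 ∨ d = 3) (hD : Bornology.IsBounded D) :
    ∃ C : NNReal, ∀ v : H10 D, eLpNorm (fn v) 4 (volume.restrict D) ≤ C * ‖v‖ₑ :=
  exists_eLpNorm_fn_le (q := 4) hd hD (by norm_num) (by norm_num)

lemma exists_eLpNorm_six_le (hd : d = 2 ∨ d = 3) (hD : Bornology.IsBounded D) :
    ∃ C : NNReal, ∀ v : H10 D, eLpNorm (fn v) 6 (volume.restrict D) ≤ C * ‖v‖ₑ :=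
  exists_eLpNorm_fn_le (q := 6) hd hD (by norm_num) le_rfl

lemma memLp_four (hd : d = 2 ∨ d = 3) (hD : Bornology.IsBounded D) (v : H10 D) :
    MemLp (fn v) 4 (volume.restrict D) := by
  obtain ⟨C, hC⟩ := exists_eLpNorm_four_le hd hD
  exact ⟨aestronglyMeasurable_fn v,
    (hC v).trans_lt (ENNReal.mul_lt_top (by simp) (by simp))⟩

lemma memLp_reProd (hd : d = 2 ∨ d = 3) (hD : Bornology.IsBounded D) (u v : H10 D) :
    MemLp (reProd u v) 2 (volume.restrict D) :=
  ⟨aestronglyMeasurable_reProd u v, (eLpNorm_reProd_le u v).trans_lt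
    (ENNReal.mul_lt_top (memLp_four hd hD u).2 (memLp_four hd hD v).2)⟩

/-- The bounded symmetric bilinear map `(u, v) ↦ Re(u v̄)`, `H¹₀(D) × H¹₀(D) → L²(D; ℝ)`. -/
lemma exists_reProd_bilin (hd : d = 2 ∨ d = 3) (hD : Bornology.IsBounded D) :
    ∃ B : H10 D →L[ℝ] H10 D →L[ℝ] Lp ℝ 2 (volume.restrict D),
      ∀ u v, B u v =ᵐ[volume.restrict D] reProd u v := by
  obtain ⟨C, hC⟩ := exists_eLpNorm_four_le hd hD
  obtain ⟨b, hb⟩ : ∃ b : H10 D → H10 D → Lp ℝ 2 (volume.restrict D), ∀ u v,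
      b u v = (memLp_reProd hd hD u v).toLp := ⟨_, fun _ _ => rfl⟩
  have hbc : ∀ u v, b u v = b v u := fun u v => by
    rw [hb, hb]
    exact MemLp.toLp_congr _ _ (ae_of_all _ (reProd_comm u v))
  have hadd : ∀ u u' v, b (u + u') v = b u v + b u' v := by
    intro u u' v
    rw [hb, hb, hb, ← MemLp.toLp_add]
    refine MemLp.toLp_congr _ _ ?_
    filter_upwards [fn_add u u'] with x hx
    simp only [reProd, hx, Pi.add_apply, add_mul, Complex.add_re]
  have hsmul : ∀ (r : ℝ) u v, b (r • u) v = r • b u v := by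
    intro r u v
    rw [hb, hb, ← MemLp.toLp_const_smul]
    refine MemLp.toLp_congr _ _ ?_
    filter_upwards [fn_smul r u] with x hx
    simp only [reProd, hx, Pi.smul_apply, smul_mul_assoc, Complex.smul_re]
  have hnorm : ∀ u v, ‖b u v‖ ≤ C ^ 2 * ‖u‖ * ‖v‖ := by
    intro u v
    rw [hb, Lp.norm_toLp]
    refine ENNReal.toReal_le_of_le_ofReal (by positivity) ?_
    refine (eLpNorm_reProd_le u v).trans ((mul_le_mul' (hC u) (hC v)).trans_eq ?_)
    rw [← ofReal_norm, ← ofReal_norm, ENNReal.ofReal_mul (by positivity),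
      ENNReal.ofReal_mul (by positivity), ENNReal.ofReal_pow (by positivity),
      ENNReal.ofReal_coe_nnreal]
    ring
  refine ⟨(LinearMap.mk₂ ℝ b hadd hsmul (fun u v v' => ?_) (fun r u v => ?_)).mkContinuous₂
    (C ^ 2) hnorm, fun u v => ?_⟩
  · rw [hbc u, hadd, hbc v, hbc v']
  · rw [hbc u, hsmul, hbc v]
  · change b u v =ᵐ[volume.restrict D] reProd u v
    rw [hb]
    exact (memLp_reProd hd hD u v).coeFn_toLp

lemma integral_reProd_mul {B : H10 D →L[ℝ] H10 D →L[ℝ] Lp ℝ 2 (volume.restrict D)}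
    (hB : ∀ u v, B u v =ᵐ[volume.restrict D] reProd u v) (u v w z : H10 D) :
    Integrable (fun x => reProd u v x * reProd w z x) (volume.restrict D) ∧
      inner ℝ (B u v) (B w z) = ∫ x in D, reProd u v x * reProd w z x := by
  have h : (fun x => inner ℝ (B u v x) (B w z x)) =ᵐ[volume.restrict D]
      fun x => reProd u v x * reProd w z x := by
    filter_upwards [hB u v, hB w z] with x h1 h2
    rw [h1, h2]
    exact mul_comm _ _
  exact ⟨(L2.integrable_inner (𝕜 := ℝ) _ _).congr h, by rw [L2.inner_def, integral_congr_ae h]⟩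

/-- Integrates the pointwise bound `Re(u v̄)² ≤ |u|² |v|²`; this supplies `B_sq_le`. -/
lemma norm_reProd_sq_le {B : H10 D →L[ℝ] H10 D →L[ℝ] Lp ℝ 2 (volume.restrict D)}
    (hB : ∀ u v, B u v =ᵐ[volume.restrict D] reProd u v) (u v : H10 D) :
    ‖B u v‖ ^ 2 ≤ inner ℝ (B u u) (B v v) := by
  rw [← real_inner_self_eq_norm_sq, (integral_reProd_mul hB u v u v).2,
    (integral_reProd_mul hB u u v v).2]
  refine integral_mono (integral_reProd_mul hB u v u v).1 (integral_reProd_mul hB u u v v).1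
    fun x => ?_
  simp only [reProd_self]
  rw [← sq, ← mul_pow, ← sq_abs]
  gcongr
  exact abs_reProd_le u v x

/-- The integrand is at most `|u|³ |w|`, and Cauchy-Schwarz puts `|u|³` in `L²`, that is `u` in
`L⁶`. Hence `B_sub` rests on the embedding with exponent six. -/
lemma eLpNorm_reProd_mul_le (u w : H10 D) :
    eLpNorm (fun x => reProd u u x * reProd u w x) 1 (volume.restrict D)
      ≤ eLpNorm (fn u) 6 (volume.restrict D) ^ 3 * eLpNorm (fn w) 2 (volume.restrict D) := by
  have hcube : eLpNorm (fun x => ‖fn u x‖ ^ (3 : ℝ)) 2 (volume.restrict D)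
      = eLpNorm (fn u) 6 (volume.restrict D) ^ 3 := by
    rw [eLpNorm_norm_rpow _ (by norm_num), ← ENNReal.rpow_natCast]
    norm_num
  have hmono : eLpNorm (fun x => reProd u u x * reProd u w x) 1 (volume.restrict D)
      ≤ eLpNorm (fun x => ‖fn u x‖ ^ (3 : ℝ) * ‖fn w x‖) 1 (volume.restrict D) := by
    refine eLpNorm_mono_ae (ae_of_all _ fun x => ?_)
    have h3 : ‖fn u x‖ ^ (3 : ℝ) = ‖fn u x‖ ^ 3 := by
      rw [← Real.rpow_natCast]; norm_num
    rw [h3, reProd_self, Real.norm_eq_abs, Real.norm_eq_abs, abs_mul,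
      abs_of_nonneg (by positivity : (0 : ℝ) ≤ ‖fn u x‖ ^ 2),
      abs_of_nonneg (by positivity : (0 : ℝ) ≤ ‖fn u x‖ ^ 3 * ‖fn w x‖)]
    calc ‖fn u x‖ ^ 2 * |reProd u w x| ≤ ‖fn u x‖ ^ 2 * (‖fn u x‖ * ‖fn w x‖) := by
          gcongr
          exact abs_reProd_le u w x
      _ = _ := by ring
  have hholder : eLpNorm (fun x => ‖fn u x‖ ^ (3 : ℝ) * ‖fn w x‖) 1 (volume.restrict D)
      ≤ eLpNorm (fun x => ‖fn u x‖ ^ (3 : ℝ)) 2 (volume.restrict D)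
        * eLpNorm (fun x => ‖fn w x‖) 2 (volume.restrict D) :=
    eLpNorm_smul_le_mul_eLpNorm (p := 2) (q := 2) (r := 1) (f := fun x => ‖fn w x‖)
      (φ := fun x => ‖fn u x‖ ^ (3 : ℝ)) (aestronglyMeasurable_fn w).norm
      ((Real.continuous_rpow_const (by norm_num)).comp_aestronglyMeasurable
        (aestronglyMeasurable_fn u).norm)
  rw [hcube, eLpNorm_norm] at hholder
  exact hmono.trans hholder

lemma eLpNorm_fn_two (w : H10 D) :
    eLpNorm (fn w) 2 (volume.restrict D) = ENNReal.ofReal ‖fstMap D w‖ := by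
  rw [ofReal_norm, Lp.enorm_def]
  rfl

lemma exists_abs_inner_reProd_le (hd : d = 2 ∨ d = 3) (hD : Bornology.IsBounded D)
    {B : H10 D →L[ℝ] H10 D →L[ℝ] Lp ℝ 2 (volume.restrict D)}
    (hB : ∀ u v, B u v =ᵐ[volume.restrict D] reProd u v) :
    ∃ C : ℝ, 0 ≤ C ∧ ∀ u w, |inner ℝ (B u u) (B u w)| ≤ C * ‖u‖ ^ 3 * ‖fstMap D w‖ := by
  obtain ⟨C, hC⟩ := exists_eLpNorm_six_le hd hD
  refine ⟨C ^ 3, by positivity, fun u w => ?_⟩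
  have key : ‖inner ℝ (B u u) (B u w)‖ₑ
      ≤ ENNReal.ofReal (C ^ 3 * ‖u‖ ^ 3 * ‖fstMap D w‖) := by
    rw [(integral_reProd_mul hB u u u w).2]
    calc ‖∫ x in D, reProd u u x * reProd u w x‖ₑ
        ≤ eLpNorm (fun x => reProd u u x * reProd u w x) 1 (volume.restrict D) := by
          rw [eLpNorm_one_eq_lintegral_enorm]
          exact enorm_integral_le_lintegral_enorm _
      _ ≤ (C * ‖u‖ₑ) ^ 3 * ENNReal.ofReal ‖fstMap D w‖ := by
          rw [← eLpNorm_fn_two]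
          exact (eLpNorm_reProd_mul_le u w).trans
            (mul_le_mul_left (pow_le_pow_left' (hC u) 3) _)
      _ = _ := by
          rw [ENNReal.ofReal_mul (by positivity), ENNReal.ofReal_mul (by positivity),
            ENNReal.ofReal_pow (by positivity), ENNReal.ofReal_pow (by positivity),
            ENNReal.ofReal_coe_nnreal, ofReal_norm u, ← mul_pow]
  rw [← ofReal_norm, Real.norm_eq_abs] at key
  exact (ENNReal.ofReal_le_ofReal_iff (by positivity)).1 key

/-- The complex quartic products are integrable. -/
lemma integrable_quartic (hd : d = 2 ∨ d = 3) (hD : Bornology.IsBounded D) (u v w z : H10 D) :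
    Integrable (fun x => fn u x * fn v x * (fn w x * fn z x)) (volume.restrict D) := by
  have := holderTriple_four_four_two
  have h1 : MemLp (fn u * fn v) 2 (volume.restrict D) :=
    (memLp_four hd hD v).mul (memLp_four hd hD u)
  have h2 : MemLp (fn w * fn z) 2 (volume.restrict D) :=
    (memLp_four hd hD z).mul (memLp_four hd hD w)
  exact h1.integrable_mul h2

lemma re_integral_cubic (hd : d = 2 ∨ d = 3) (hD : Bornology.IsBounded D)
    {B : H10 D →L[ℝ] H10 D →L[ℝ] Lp ℝ 2 (volume.restrict D)}
    (hB : ∀ u v, B u v =ᵐ[volume.restrict D] reProd u v) (u v w : H10 D) :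
    (∫ x in D, ((‖fn u x‖ ^ 2 : ℝ) : ℂ) * fn v x * conj (fn w x)).re
      = inner ℝ (B u u) (B v w) := by
  rw [(integral_reProd_mul hB u u v w).2, ← RCLike.re_to_complex, ← integral_re]
  · refine integral_congr_ae (ae_of_all _ fun x => ?_)
    simp only [RCLike.re_to_complex]
    rw [mul_assoc, Complex.re_ofReal_mul, reProd_self, reProd]
  · refine (integrable_quartic hd hD u u v w).mono ?_ (ae_of_all _ fun x => ?_)
    · exact ((Complex.continuous_ofReal.comp_aestronglyMeasurable
        ((aestronglyMeasurable_fn u).norm.pow 2)).mul (aestronglyMeasurable_fn v)).mul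
        (Complex.continuous_conj.comp_aestronglyMeasurable (aestronglyMeasurable_fn w))
    · simp only [norm_mul, RCLike.norm_conj, Complex.norm_real, Real.norm_eq_abs, abs_pow,
        abs_norm]
      exact le_of_eq (by ring)

/-- Since `u v̄ + v ū = 2 Re(u v̄)`, the bracket is `2 Re(u v̄) + v ū`; times `u w̄` it has the real
part `2 Re(u v̄) Re(u w̄) + |u|² Re(v w̄)`. -/
lemma re_integral_J (hd : d = 2 ∨ d = 3) (hD : Bornology.IsBounded D)
    {B : H10 D →L[ℝ] H10 D →L[ℝ] Lp ℝ 2 (volume.restrict D)}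
    (hB : ∀ u v, B u v =ᵐ[volume.restrict D] reProd u v) (u v w : H10 D) :
    (∫ x in D, (fn u x * conj (fn v x) + 2 * fn v x * conj (fn u x)) * fn u x
      * conj (fn w x)).re = 2 * inner ℝ (B u v) (B u w) + inner ℝ (B u u) (B v w) := by
  rw [(integral_reProd_mul hB u v u w).2, (integral_reProd_mul hB u u v w).2,
    ← RCLike.re_to_complex, ← integral_re, ← integral_const_mul, ← integral_add]
  · refine integral_congr_ae (ae_of_all _ fun x => ?_)
    simp only [RCLike.re_to_complex, reProd, Complex.add_re, Complex.add_im, Complex.mul_re,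
      Complex.mul_im, Complex.conj_re, Complex.conj_im, Complex.re_ofNat, Complex.im_ofNat]
    ring
  · exact (integral_reProd_mul hB u v u w).1.const_mul 2
  · exact (integral_reProd_mul hB u u v w).1
  · have hc := fun y : H10 D =>
      Complex.continuous_conj.comp_aestronglyMeasurable (aestronglyMeasurable_fn y)
    refine ((integrable_quartic hd hD u u v w).const_mul 3).mono ?_ (ae_of_all _ fun x => ?_)
    · exact (((((aestronglyMeasurable_fn u).mul (hc v)).add
        (((aestronglyMeasurable_fn v).const_mul 2).mul (hc u))).mul
        (aestronglyMeasurable_fn u)).mul (hc w))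
    · simp only [norm_mul, RCLike.norm_conj, RCLike.norm_ofNat]
      calc ‖fn u x * conj (fn v x) + 2 * fn v x * conj (fn u x)‖ * ‖fn u x‖ * ‖fn w x‖
          ≤ (‖fn u x‖ * ‖fn v x‖ + 2 * ‖fn v x‖ * ‖fn u x‖) * ‖fn u x‖ * ‖fn w x‖ := by
            gcongr
            refine (norm_add_le _ _).trans_eq ?_
            simp
        _ = _ := by ring

lemma energy_eq {B : H10 D →L[ℝ] H10 D →L[ℝ] Lp ℝ 2 (volume.restrict D)}
    (hB : ∀ u v, B u v =ᵐ[volume.restrict D] reProd u v) {W : Space d → ℝ} {Ω : ℝ} (κ : ℝ)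
    {u : H10 D} {q : ℝ}
    (hint : Integrable (fun x => ‖rotGrad Ω u x‖ ^ 2 + rotPotential W Ω x * ‖fn u x‖ ^ 2)
      (volume.restrict D))
    (hq : q = ∫ x in D, (‖rotGrad Ω u x‖ ^ 2 + rotPotential W Ω x * ‖fn u x‖ ^ 2)) :
    energy W Ω κ u = 1 / 2 * q + κ / 4 * ‖B u u‖ ^ 2 := by
  have hquart : ∀ x, κ / 2 * (reProd u u x * reProd u u x) = κ / 2 * ‖fn u x‖ ^ 4 := by
    intro x
    rw [reProd_self]
    ring
  obtain ⟨hi', h2⟩ := integral_reProd_mul hB u u u u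
  have hi : Integrable (fun x => κ / 2 * ‖fn u x‖ ^ 4) (volume.restrict D) :=
    (hi'.const_mul (κ / 2)).congr (ae_of_all _ hquart)
  have h1 : ∫ x in D, κ / 2 * ‖fn u x‖ ^ 4 = κ / 2 * ‖B u u‖ ^ 2 := by
    rw [← integral_congr_ae (ae_of_all _ hquart), integral_const_mul, ← h2,
      real_inner_self_eq_norm_sq (B u u)]
  have h4 := integral_add hint hi
  rw [← hq, h1] at h4
  rw [energy, h4]
  ring

lemma re_add_ofReal_mul {x y : ℂ} {X Y c : ℝ} (hx : x.re = X) (hy : y.re = Y) :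
    (x + (c : ℂ) * y).re = X + c * Y := by
  rw [Complex.add_re, Complex.re_ofReal_mul, hx, hy]

lemma re_sub_ofReal_mul {x y : ℂ} {X Y c : ℝ} (hx : x.re = X) (hy : y.re = Y) :
    (x - (c : ℂ) * y).re = X - c * Y := by
  rw [Complex.sub_re, Complex.re_ofReal_mul, hx, hy]

/-! ### The concrete problem as an instance of the abstract one -/

/-- The Gross-Pitaevskii problem as an instance of the abstract setting. -/
lemma exists_gpForm (hd : d = 2 ∨ d = 3) (hDm : MeasurableSet D)
    (hD : Bornology.IsBounded D) {W : Space d → ℝ} (hW : MemLp W ⊤ (volume.restrict D))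
    (Ω : ℝ) {κ : ℝ} (hκ : 0 ≤ κ)
    (hWΩ : ∀ᵐ x ∂(volume.restrict D), Ω ^ 2 * ‖x‖ ^ 2 ≤ W x) :
    ∃ S : GPForm (H10 D) (L2 D) (Lp ℝ 2 (volume.restrict D)),
      S.ι = fstMap D ∧ (∀ u, S.E u = energy W Ω κ u) ∧
      (∀ u w, l2Norm u = 1 → opA W Ω κ u u w = S.dE u w) ∧
      ∀ σ u v w, opJσ W Ω κ σ u v w = S.J σ u v w := by
  obtain ⟨a, α, hα, ha, hsymm, hcoer, hint, hdiag⟩ := exists_linearForm_bilin hd hDm hD hW Ω hWΩ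
  obtain ⟨B, hB⟩ := exists_reProd_bilin hd hD
  obtain ⟨C, hC0, hC⟩ := exists_abs_inner_reProd_le hd hD hB
  have hBsymm : ∀ v w, B v w = B w v := by
    intro v w
    refine Lp.ext ?_
    filter_upwards [hB v w, hB w v] with x h1 h2
    rw [h1, h2, reProd_comm]
  have hcubic := re_integral_cubic hd hD hB
  have hJterm := re_integral_J hd hD hB
  obtain ⟨S, hSι, hSE, hSdE, hSJ⟩ : ∃ S : GPForm (H10 D) (L2 D) (Lp ℝ 2 (volume.restrict D)),
      S.ι = fstMap D ∧ (∀ u, S.E u = 1 / 2 * a u u + κ / 4 * ‖B u u‖ ^ 2) ∧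
      (∀ u w, S.dE u w = a u w + κ * inner ℝ (B u u) (B u w)) ∧
      (∀ σ u v w, S.J σ u v w = a v w
        + κ / ‖fstMap D u‖ ^ 2 * (2 * inner ℝ (B u v) (B u w) + inner ℝ (B u u) (B v w))
        - 2 * κ * inner ℝ (fstMap D u) (fstMap D v) / ‖fstMap D u‖ ^ 4 * inner ℝ (B u u) (B u w)
        + σ * inner ℝ (fstMap D v) (fstMap D w)) :=
    ⟨⟨a, fstMap D, B, κ, α, C, hκ, hα, hC0, hsymm, hcoer, hBsymm, norm_reProd_sq_le hB, hC,
      fun v ⟨M, hM⟩ => exists_subseq_cauchySeq_fst hD hM⟩, rfl, fun _ => rfl, fun _ _ => rfl,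
      fun _ _ _ _ => rfl⟩
  refine ⟨S, hSι, fun u => ?_, fun u w hu => ?_, fun σ u v w => ?_⟩
  · exact (hSE u).trans (energy_eq hB κ (hint u) (hdiag u)).symm
  · have h : opA W Ω κ u u w = a u w + κ / l2Norm u ^ 2 * inner ℝ (B u u) (B u w) :=
      re_add_ofReal_mul (ha u w).symm (hcubic u u w)
    rw [hu, one_pow, div_one] at h
    exact h.trans (hSdE u w).symm
  · have h : opJ W Ω κ u v w = a v w
        + κ / l2Norm u ^ 2 * (2 * inner ℝ (B u v) (B u w) + inner ℝ (B u u) (B v w))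
        - 2 * κ * hInner u v / l2Norm u ^ 4 * inner ℝ (B u u) (B u w) :=
      re_sub_ofReal_mul (re_add_ofReal_mul (ha v w).symm (hJterm u v w)) (hcubic u u w)
    have h' := congrArg (fun t => a v w
        + κ / l2Norm u ^ 2 * (2 * inner ℝ (B u v) (B u w) + inner ℝ (B u u) (B v w))
        - 2 * κ * t / l2Norm u ^ 4 * inner ℝ (B u u) (B u w)) (hInner_eq u v)
    exact (congrArg₂ (· + ·) (h.trans h') (congrArg (σ * ·) (hInner_eq v w))).trans
      (hSJ σ u v w).symm

/-! ### The damped `J`-method -/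

lemma coe_smul_H10 (r : ℝ) (v : H10 D) : (r : ℂ) • v = r • v :=
  (RCLike.real_smul_eq_coe_smul (K := ℂ) r v).symm

lemma l2Norm_eq (v : H10 D) : l2Norm v = ‖fstMap D v‖ := rfl

section Step

variable {S : GPForm (H10 D) (L2 D) (Lp ℝ 2 (volume.restrict D))} {W : Space d → ℝ}
  {Ω κ σ : ℝ}

lemma existsUnique_opJσ (hι : S.ι = fstMap D) (hE : ∀ u, S.E u = energy W Ω κ u)
    (hJ : ∀ σ u v w, opJσ W Ω κ σ u v w = S.J σ u v w) {u : H10 D} (hu : l2Norm u = 1)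
    (hσ : 4 / 3 * energy W Ω κ u ≤ σ) (F : H10 D →L[ℝ] ℝ) :
    ∃! z : H10 D, ∀ w : H10 D, opJσ W Ω κ σ u z w = F w := by
  have h := S.existsUnique_J (σ := σ) (u := u) (by rw [hι]; exact hu) (by rw [hE]; exact hσ) F
  simpa only [hJ] using h

/-- One step of the damped `J`-method. -/
lemma step_properties (hι : S.ι = fstMap D) (hE : ∀ u, S.E u = energy W Ω κ u)
    (hJ : ∀ σ u v w, opJσ W Ω κ σ u v w = S.J σ u v w) {u : H10 D} (hu : l2Norm u = 1)
    {e t : ℝ} (he : energy W Ω κ u ≤ e) (hσ : 4 / 3 * e ≤ σ) (ht : 0 < t)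
    (ht' : t ≤ S.tauMax e) :
    StepWellPosed W Ω κ σ t u ∧ l2Norm (dampedStep W Ω κ σ t u) = 1 ∧
    ∃ (v : H10 D) (μ : ℝ),
      energy W Ω κ (dampedStep W Ω κ σ t u) ≤ energy W Ω κ u - t / 2 * S.a v v ∧
      ∀ w, S.J σ u v w = μ * inner ℝ (S.ι u) (S.ι w) - S.dE u w := by
  have hι' : ∀ v, S.ι v = fstMap D v := fun v => by rw [hι]
  have hinv : JσInvertible W Ω κ σ u := fun F => existsUnique_opJσ hι hE hJ hu (by linarith) F
  -- `(u, ·)_H` is a bounded functional, so invertibility excludes the default value `0` in `JσInv`.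
  have hz : ∀ w, S.J σ u (JσInv W Ω κ σ u) w = inner ℝ (S.ι u) (S.ι w) := by
    have h : ∃! z : H10 D, ∀ w : H10 D, opJσ W Ω κ σ u z w = hInner u w := by
      obtain ⟨z, hz, huz⟩ := hinv (GPForm.innerBilin (L2 D) (fstMap D u) ∘L fstMap D)
      exact ⟨z, fun w => (hz w).trans (hInner_eq u w).symm,
        fun y hy => huz y fun w => (hy w).trans (hInner_eq u w)⟩
    intro w
    have h2 := h.exists.choose_spec w
    rw [← hJ, JσInv, dif_pos h, h2, hInner_eq, hι', hι']
  have hg : inner ℝ (S.ι (JσInv W Ω κ σ u)) (S.ι u) = gammaInv W Ω κ σ u := by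
    rw [gammaInv, hInner_eq, hι', hι']
  have hstep := S.damped_step (by rw [hι']; exact hu) (by rw [hE]; exact he) hσ ht ht' hz
  rw [hg] at hstep
  have htilde : (1 - t) • u + (t * (gammaInv W Ω κ σ u)⁻¹) • JσInv W Ω κ σ u
      = dampedTilde W Ω κ σ t u := by
    rw [dampedTilde, coe_smul_H10, coe_smul_H10]
  rw [htilde, hι'] at hstep
  obtain ⟨h1, h2, h3, h4⟩ := hstep
  have hpos : 0 < l2Norm (dampedTilde W Ω κ σ t u) := zero_lt_one.trans_le h2
  have hdamped : dampedStep W Ω κ σ t u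
      = ‖fstMap D (dampedTilde W Ω κ σ t u)‖⁻¹ • dampedTilde W Ω κ σ t u := by
    rw [dampedStep, coe_smul_H10, l2Norm_eq]
  refine ⟨⟨hinv, h1.ne', hpos.ne'⟩, ?_, _, _, ?_, h4⟩
  · rw [hdamped, l2Norm_eq, map_smul, norm_smul, norm_inv, norm_norm]
    exact inv_mul_cancel₀ hpos.ne'
  · rw [hdamped, ← hE, ← hE]
    exact h3

lemma isEigenpair_of_dE (hι : S.ι = fstMap D)
    (hA : ∀ u w, l2Norm u = 1 → opA W Ω κ u u w = S.dE u w) {u : H10 D} (hu : l2Norm u = 1)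
    {lam : ℝ} (h : ∀ w, S.dE u w = lam * inner ℝ (S.ι u) (S.ι w)) :
    IsEigenpair W Ω κ u lam := by
  refine ⟨hu, fun w => ?_⟩
  rw [hA u w hu, h, hInner_eq, hι]

end Step

/-- A sequence all of whose subsequences have subsequences converging to a unimodular multiple
of `u'` converges up to phase factors. -/
lemma exists_phase_tendsto {V : Type*} [NormedAddCommGroup V] [NormedSpace ℂ V] {u : ℕ → V}
    {u' : V} (h : ∀ θ : ℕ → ℕ, Tendsto θ atTop atTop →
      ∃ (φ : ℕ → ℕ) (c : ℂ), ‖c‖ = 1 ∧ Tendsto (fun k => u (θ (φ k))) atTop (𝓝 (c • u'))) :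
    ∃ c : ℕ → ℂ, (∀ n, ‖c n‖ = 1) ∧ Tendsto (fun n => c n • u n) atTop (𝓝 u') := by
  -- The phase `c n` is the best one for `u n`. Along a subsequence it does at least as well as the
  -- fixed phase `conj a`, which already gives convergence.
  have hmin : ∀ n, ∃ c ∈ Metric.sphere (0 : ℂ) 1,
      IsMinOn (fun c : ℂ => dist (c • u n) u') (Metric.sphere (0 : ℂ) 1) c := fun n =>
    (isCompact_sphere (0 : ℂ) 1).exists_isMinOn ⟨1, by simp⟩
      (Continuous.continuousOn (by fun_prop))
  choose c hc hcmin using hmin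
  refine ⟨c, fun n => by simpa using hc n, tendsto_of_subseq_tendsto fun θ hθ => ?_⟩
  obtain ⟨φ, a, ha, hlim⟩ := h θ hθ
  refine ⟨φ, ?_⟩
  have h1 : Tendsto (fun k => dist (conj a • u (θ (φ k))) u') atTop (𝓝 0) := by
    have h2 := ((hlim.const_smul (conj a)).dist (tendsto_const_nhds (x := u')))
    have h3 : conj a • a • u' = u' := by
      rw [smul_smul, mul_comm, Complex.mul_conj, Complex.normSq_eq_norm_sq, ha]
      simp
    rwa [h3, dist_self] at h2
  rw [tendsto_iff_dist_tendsto_zero]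
  exact squeeze_zero (fun _ => dist_nonneg)
    (fun k => hcmin (θ (φ k)) (by simpa using ha)) h1

end GrossPitaevskii

end

/-! ### Convergence of the damped `J`-method -/

open GrossPitaevskii in
theorem mainTheorem4 {d : ℕ} (hd : d = 2 ∨ d = 3)
    (D : Set (Space d)) (hD_open : IsOpen D) (hD_bdd : Bornology.IsBounded D)
    (W : Space d → ℝ) (hW : MemLp W ⊤ (volume.restrict D))
    (Ω κ : ℝ) (hκ : 0 ≤ κ)
    (hWΩ : ∀ᵐ x ∂(volume.restrict D), Ω ^ 2 * ‖x‖ ^ 2 ≤ W x)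
    (u₀ : H10 D) (hu₀ : l2Norm u₀ = 1) :
    ∃ τmax : ℝ, 0 < τmax ∧
      ∀ σ : ℝ, 4 / 3 * energy W Ω κ u₀ ≤ σ →
      ∀ τ : ℕ → ℝ, (∃ c : ℝ, 0 < c ∧ ∀ n, c ≤ τ n) → (∀ n, τ n ≤ τmax) →
      ∀ u : ℕ → H10 D, u = dampedJ W Ω κ σ τ u₀ →
        -- `τmax` is a step size bound for well-posedness and energy reduction
        (∀ n, StepWellPosed W Ω κ σ (τ n) (u n)) ∧
        (∀ n, energy W Ω κ (u (n + 1)) ≤ energy W Ω κ (u n)) ∧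
        (∀ n, (¬ ∃ lam : ℝ, IsEigenpair W Ω κ (u n) lam) →
          energy W Ω κ (u (n + 1)) < energy W Ω κ (u n)) ∧
        -- convergence
        ∃ Estar : ℝ, Tendsto (fun n => energy W Ω κ (u n)) atTop (𝓝 Estar) ∧
        ∃ (φ : ℕ → ℕ) (ustar : H10 D) (lamstar : ℝ), StrictMono φ ∧
          Tendsto (fun k => u (φ k)) atTop (𝓝 ustar) ∧
          IsEigenpair W Ω κ ustar lamstar ∧ 0 < lamstar ∧
          energy W Ω κ ustar = Estar ∧
          -- uniqueness on the energy level, among the elements of a closed set that contains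
          -- the iterates (for instance `Set.univ`)
          (∀ K : Set (H10 D), IsClosed K → (∀ n, u n ∈ K) →
            (∀ (v : H10 D) (lam : ℝ), v ∈ K → IsEigenpair W Ω κ v lam →
              energy W Ω κ v = Estar → v = ustar) →
            Tendsto u atTop (𝓝 ustar)) ∧
          -- uniqueness on the energy level up to constant phase factors
          ((∀ (v : H10 D) (lam : ℝ), IsEigenpair W Ω κ v lam → energy W Ω κ v = Estar →
              ∃ c : ℂ, ‖c‖ = 1 ∧ v = c • ustar) →
            ∃ c : ℕ → ℂ, (∀ n, ‖c n‖ = 1) ∧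
              Tendsto (fun n => c n • u n) atTop (𝓝 ustar)) := by
  obtain ⟨S, hι, hE, hA, hJ⟩ := exists_gpForm hd hD_open.measurableSet hD_bdd hW Ω hκ hWΩ
  have hι' : ∀ v, S.ι v = fstMap D v := fun v => by rw [hι]
  -- The initial energy level fixes the step bound; as energies never rise above it, both this bound
  -- and `σ ≥ 4/3 E(uⁿ)` persist.
  refine ⟨S.tauMax (energy W Ω κ u₀), S.tauMax_pos (hE u₀).le, ?_⟩
  intro σ hσ τ ⟨c, hc0, hc⟩ hτ u hu
  have hτ0 : ∀ n, 0 < τ n := fun n => hc0.trans_le (hc n)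
  have hsucc : ∀ n, u (n + 1) = dampedStep W Ω κ σ (τ n) (u n) := fun n => by rw [hu]; rfl
  have hstep : ∀ n, l2Norm (u n) = 1 → energy W Ω κ (u n) ≤ energy W Ω κ u₀ →
      StepWellPosed W Ω κ σ (τ n) (u n) ∧ l2Norm (u (n + 1)) = 1 ∧
      ∃ (v : H10 D) (μ : ℝ),
        energy W Ω κ (u (n + 1)) ≤ energy W Ω κ (u n) - τ n / 2 * S.a v v ∧
        ∀ w, S.J σ (u n) v w = μ * inner ℝ (S.ι (u n)) (S.ι w) - S.dE (u n) w := by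
    intro n h1 h2
    rw [hsucc]
    exact step_properties hι hE hJ h1 h2 hσ (hτ0 n) (hτ n)
  have hind : ∀ n, l2Norm (u n) = 1 ∧ energy W Ω κ (u n) ≤ energy W Ω κ u₀ := by
    intro n
    induction n with
    | zero => rw [hu]; exact ⟨hu₀, le_rfl⟩
    | succ n ih =>
      obtain ⟨-, h1, v, μ, h2, -⟩ := hstep n ih.1 ih.2
      have h3 : 0 ≤ τ n / 2 * S.a v v := mul_nonneg (by linarith [hτ0 n]) (S.a_nonneg v)
      exact ⟨h1, by linarith [ih.2]⟩
  have hall := fun n => hstep n (hind n).1 (hind n).2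
  choose hwp hnorm v μ hdesc hres using hall
  have hav : ∀ n, 0 ≤ τ n / 2 * S.a (v n) (v n) := fun n =>
    mul_nonneg (by linarith [hτ0 n]) (S.a_nonneg _)
  have hmono : ∀ n, energy W Ω κ (u (n + 1)) ≤ energy W Ω κ (u n) := fun n => by
    linarith [hdesc n, hav n]
  have hEtend : Tendsto (fun n => energy W Ω κ (u n)) atTop (𝓝 (⨅ n, energy W Ω κ (u n))) :=
    tendsto_atTop_ciInf (antitone_nat_of_succ_le hmono)
      ⟨0, by rintro _ ⟨n, rfl⟩; exact (S.E_nonneg (u n)).trans_eq (hE (u n))⟩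
  set Estar := ⨅ n, energy W Ω κ (u n)
  -- Consecutive energies have vanishing differences; the lower bound `c ≤ τ n` and coercivity
  -- transfer this to `‖v n‖²`.
  have hv : Tendsto v atTop (𝓝 0) := by
    have hdiff : Tendsto (fun n => (energy W Ω κ (u n) - energy W Ω κ (u (n + 1)))
        / (c / 2 * S.α)) atTop (𝓝 0) := by
      have := (hEtend.sub (hEtend.comp (tendsto_add_atTop_nat 1))).div_const (c / 2 * S.α)
      simpa using this
    have hsq : Tendsto (fun n => ‖v n‖ ^ 2) atTop (𝓝 0) := by
      refine squeeze_zero (fun _ => sq_nonneg _) (fun n => ?_) hdiff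
      have hα := S.α_pos
      rw [le_div_iff₀ (by positivity)]
      have h1 : c / 2 * (S.α * ‖v n‖ ^ 2) ≤ τ n / 2 * S.a (v n) (v n) :=
        mul_le_mul (by linarith [hc n]) (S.a_coercive _) (by positivity) (by linarith [hτ0 n])
      have h2 := hdesc n
      linarith
    have := hsq.sqrt
    rw [tendsto_zero_iff_norm_tendsto_zero]
    simpa [Real.sqrt_sq (norm_nonneg _)] using this
  -- Stated for every `θ` tending to infinity: `θ = id` gives the convergent subsequence, general
  -- `θ` the two uniqueness statements.
  have hsub : ∀ θ : ℕ → ℕ, Tendsto θ atTop atTop → ∃ (φ : ℕ → ℕ) (u' : H10 D) (lam : ℝ),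
      StrictMono φ ∧ Tendsto (fun k => u (θ (φ k))) atTop (𝓝 u') ∧ IsEigenpair W Ω κ u' lam ∧
      0 < lam ∧ energy W Ω κ u' = Estar := by
    intro θ hθ
    obtain ⟨φ, u', hφ, hlim, hn, heig⟩ := S.exists_subseq_tendsto_eigen (σ := σ)
      (e := energy W Ω κ u₀) (u := fun k => u (θ k)) (v := fun k => v (θ k))
      (μ := fun k => μ (θ k)) (fun k => by rw [hι']; exact (hind (θ k)).1)
      (fun k => by rw [hE]; exact (hind (θ k)).2) (hv.comp hθ) (fun k => hres (θ k))
    have hn' : l2Norm u' = 1 := by rw [hι'] at hn; exact hn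
    refine ⟨φ, u', S.dE u' u', hφ, hlim, isEigenpair_of_dE hι hA hn' heig, S.dE_self_pos hn, ?_⟩
    have h1 := (S.continuous_E.tendsto u').comp hlim
    have h2 := hEtend.comp (hθ.comp hφ.tendsto_atTop)
    rw [← hE]
    exact tendsto_nhds_unique h1 (h2.congr fun k => (hE _).symm)
  refine ⟨hwp, hmono, fun n hn => ?_, Estar, hEtend, ?_⟩
  -- For `v n = 0` the residual identity is the eigenvalue equation with eigenvalue `μ n`.
  · have hvn : v n ≠ 0 := by
      intro h0
      refine hn ⟨μ n, isEigenpair_of_dE hι hA (hind n).1 fun w => ?_⟩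
      have h1 := hres n w
      rw [h0, ← S.Jform_apply, map_zero] at h1
      have h2 : (0 : H10 D →L[ℝ] ℝ) w = 0 := rfl
      linarith
    have h1 : 0 < τ n / 2 * S.a (v n) (v n) := mul_pos (by linarith [hτ0 n]) (S.a_pos hvn)
    linarith [hdesc n]
  · obtain ⟨φ, ustar, lam, hφ, hlim, heig, hlam, hen⟩ := hsub id tendsto_id
    refine ⟨φ, ustar, lam, hφ, hlim, heig, hlam, hen, fun K hK huK huniq => ?_, fun huniq => ?_⟩
    · refine tendsto_of_subseq_tendsto fun θ hθ => ?_
      obtain ⟨ψ, u', lam', -, hlim', heig', -, hen'⟩ := hsub θ hθ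
      have hmem : u' ∈ K := hK.mem_of_tendsto hlim' (Eventually.of_forall fun k => huK _)
      exact ⟨ψ, huniq u' lam' hmem heig' hen' ▸ hlim'⟩
    · refine exists_phase_tendsto fun θ hθ => ?_
      obtain ⟨ψ, u', lam', -, hlim', heig', -, hen'⟩ := hsub θ hθ
      obtain ⟨b, hb, rfl⟩ := huniq u' lam' heig' hen'
      exact ⟨ψ, b, hb, hlim'⟩
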